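/- Throughout, $p$ denotes a prime and $\nu$ an integer $\geq 1$. For real $x\ge 1$, $A>0$, $B>0$, let $\mathcal M(x;A,B)$ be the class of multiplicative functions $f:\mathbb N^*\to\mathbb C$ (with $f(1)=1$) such that $$\max_{p\le x}|f(p)|\le A,\qquad \sum_{\substack{p^\nu\le x\\ \nu\ge 2}}\frac{|f(p^\nu)|\log p^\nu}{p^\nu}\le B,$$ the first condition being void if $x<2$. Theorem. For all $A>0$, $B>0$ there is a constant $C=C(A,B)$ with the following property. Let $x\ge 1$, let $\lambda\in\mathcal M(x;A,B)$ take only real non-negative values, and let $\vartheta:\mathbb N^*\to\mathbb C$ be additive, i.e. $\vartheta(mn)=\vartheta(m)+\vartheta(n)$ for all coprime $m,n\ge 1$. Put $$\Theta(x):=\sum_{p^\nu\le x}\frac{\lambda(p^\nu)\vartheta(p^\nu)}{p^\nu},\qquad \mathfrak S(x):=\sum_{p^\nu\le x}\frac{\lambda(p^\nu)|\vartheta(p^\nu)|^2}{p^\nu}.$$ Then $$\sum_{n\le x}\frac{\lambda(n)}{n}\,|\vartheta(n)-\Theta(x)|^2\le C\,\Big(\sum_{n\le x}\frac{\lambda(n)}{n}\Big)\,\mathfrak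 S(x).$$ -/

import Mathlib

/-- The prime powers `p ^ ν ≤ x` with `p` prime and `ν ≥ 1`. -/
noncomputable def primePowersUpTo (x : ℝ) : Finset ℕ :=
  (Finset.Icc 1 ⌊x⌋₊).filter (fun q => IsPrimePow q)

/-- The prime powers `p ^ ν ≤ x` with `p` prime and `ν ≥ 2`. -/
noncomputable def properPrimePowersUpTo (x : ℝ) : Finset ℕ :=
  (primePowersUpTo x).filter (fun q => ¬ q.Prime)

/-- The class `M(x; A, B)` of multiplicative functions `f` (with `f 1 = 1`) such that
`|f p| ≤ A` for all primes `p ≤ x`, and the sum of `|f (p ^ ν)| * log (p ^ ν) / p ^ ν` over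
the prime powers `p ^ ν ≤ x` with `ν ≥ 2` is at most `B`. -/
structure MemMultClass {𝕜 : Type*} [RCLike 𝕜] (x A B : ℝ) (f : ArithmeticFunction 𝕜) :
    Prop where
  isMultiplicative : f.IsMultiplicative
  norm_prime_le : ∀ p : ℕ, p.Prime → (p : ℝ) ≤ x → ‖f p‖ ≤ A
  sum_le : ∑ q ∈ properPrimePowersUpTo x, ‖f q‖ * Real.log (q : ℝ) / (q : ℝ) ≤ B

/-- Additive arithmetic functions. The value at `0` is irrelevant. -/
def IsAdditiveArith (θ : ℕ → ℂ) : Prop :=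
  ∀ m n : ℕ, 0 < m → 0 < n → m.Coprime n → θ (m * n) = θ m + θ n

/-- The weighted sum of `l (p ^ ν) * θ (p ^ ν) / p ^ ν` over the prime powers `p ^ ν ≤ x`. -/
noncomputable def firstMoment (l : ArithmeticFunction ℝ) (θ : ℕ → ℂ) (x : ℝ) : ℂ :=
  ∑ q ∈ primePowersUpTo x, (l q : ℂ) * θ q / (q : ℂ)

/-- The weighted sum of `l (p ^ ν) * |θ (p ^ ν)| ^ 2 / p ^ ν` over the prime powers
`p ^ ν ≤ x`. -/
noncomputable def secondMoment (l : ArithmeticFunction ℝ) (θ : ℕ → ℂ) (x : ℝ) : ℝ :=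
  ∑ q ∈ primePowersUpTo x, l q * ‖θ q‖ ^ 2 / (q : ℝ)

/-! Write `w n = l n / n`, let `N` be the integer part of `x`, `S` the sum of `w` up to `N`, and `L
= 1 + log N`. An additive function is the sum of its values at the prime powers exactly dividing
`n`. Proper prime powers have total weight at most `2 * B`, so their part and its centre need only
Cauchy–Schwarz. The primes can have unbounded total weight, and there cancellation is needed.

Centre the indicator of `p ∥ n` at `w p` and expand the square. The diagonal is harmless. The term
of two primes `p < r` is `w p * w r * K(p, r)`, with `K` the `covarianceKernel`. Its summand is
nonzero only if `n > N / p`, or `p ∣ n` and `n > N / r`, or both primes divide `n`, or `N / (p r) <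
n ≤ N / r`. Apart from divisibility, these conditions put `n` in short logarithmic intervals.

Such intervals carry little weight: since `log n` is the sum of `log q` over the prime powers `q ∥
n`, exchanging summations and applying Chebyshev's bound shows that `y / d < n ≤ y` carries weight
`O(S (1 + log d) / (1 + log y))` (`sum_short_le`). With the analogue for multiples of `p`, this
bounds `K(p, r) / S` by a finite sum of products `g p * k r` (`abs_covarianceKernel_le_of_lt`). Each
factor satisfies `∑ w p * g p ^ 2 ≤ M` with `M` depending only on `A` and `B`, so Cauchy–Schwarz
bounds every resulting bilinear form by `M * ∑ w p * ‖θ p‖ ^ 2`. -/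

section LogTuranKubilius
open Finset

/-! ### Unitary divisors and additive functions. -/

/-- `q` is a unitary divisor of `n`. -/
def UnitaryDvd (q n : ℕ) : Prop := q ∣ n ∧ q.Coprime (n / q)

instance (q n : ℕ) : Decidable (UnitaryDvd q n) := inferInstanceAs (Decidable (_ ∧ _))

theorem unitaryDvd_mul_right {q m : ℕ} (hq : 0 < q) : UnitaryDvd q (q * m) ↔ q.Coprime m := by
  simp [UnitaryDvd, Nat.mul_div_cancel_left m hq]

theorem unitaryDvd_mul_left_iff {q r m : ℕ} (h : q.Coprime r) :
    UnitaryDvd r (q * m) ↔ UnitaryDvd r m := by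
  constructor
  · rintro ⟨h1, h2⟩
    have h3 : r ∣ m := h.symm.dvd_of_dvd_mul_left h1
    rw [Nat.mul_div_assoc _ h3] at h2
    exact ⟨h3, (Nat.coprime_mul_iff_right.1 h2).2⟩
  · rintro ⟨h1, h2⟩
    refine ⟨h1.mul_left _, ?_⟩
    rw [Nat.mul_div_assoc _ h1]
    exact Nat.coprime_mul_iff_right.2 ⟨h.symm, h2⟩

theorem unitaryDvd_prime_pow_iff {p k n : ℕ} (hp : p.Prime) (hk : k ≠ 0) (hn : n ≠ 0) :
    UnitaryDvd (p ^ k) n ↔ n.factorization p = k := by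
  constructor
  · rintro ⟨⟨m, rfl⟩, h2⟩
    rw [Nat.mul_div_cancel_left m (pow_pos hp.pos k)] at h2
    have hm : m ≠ 0 := right_ne_zero_of_mul hn
    have h3 : ¬ p ∣ m := fun h =>
      (Nat.Prime.coprime_iff_not_dvd hp).1 ((Nat.coprime_pow_left_iff (Nat.pos_of_ne_zero hk) _ _).1 h2) h
    rw [Nat.factorization_mul (pow_ne_zero _ hp.ne_zero) hm]
    simp [hp.factorization_self, Nat.factorization_eq_zero_of_not_dvd h3]
  · rintro rfl
    exact ⟨Nat.ordProj_dvd n p, (Nat.coprime_ordCompl hp hn).pow_left _⟩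

theorem UnitaryDvd.coprime_of_ne {q r n : ℕ} (hq : IsPrimePow q) (hr : IsPrimePow r)
    (hn : n ≠ 0) (hqn : UnitaryDvd q n) (hrn : UnitaryDvd r n) (hne : q ≠ r) : q.Coprime r := by
  obtain ⟨p, k, hp, hk, rfl⟩ := (isPrimePow_nat_iff q).1 hq
  obtain ⟨p', k', hp', hk', rfl⟩ := (isPrimePow_nat_iff r).1 hr
  rw [unitaryDvd_prime_pow_iff hp hk.ne' hn] at hqn
  rw [unitaryDvd_prime_pow_iff hp' hk'.ne' hn] at hrn
  refine Nat.Coprime.pow _ _ ((Nat.coprime_primes hp hp').2 ?_)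
  rintro rfl
  exact hne (by rw [← hqn, ← hrn])

theorem image_primeFactors_ordProj {n N : ℕ} (hn : n ∈ Icc 1 N) :
    n.primeFactors.image (fun p => p ^ n.factorization p) =
      {q ∈ Icc 1 N | IsPrimePow q ∧ UnitaryDvd q n} := by
  obtain ⟨h1, h2⟩ := mem_Icc.1 hn
  have h0 : n ≠ 0 := by omega
  ext q
  simp only [mem_image, mem_filter, mem_Icc]
  constructor
  · rintro ⟨p, hp, rfl⟩
    have hpp := Nat.prime_of_mem_primeFactors hp
    have hk : n.factorization p ≠ 0 := by
      rwa [← Finsupp.mem_support_iff, Nat.support_factorization]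
    exact ⟨⟨Nat.one_le_pow _ _ hpp.pos, (Nat.ordProj_le p h0).trans h2⟩,
      hpp.isPrimePow.pow hk, (unitaryDvd_prime_pow_iff hpp hk h0).2 rfl⟩
  · rintro ⟨-, hq, hqn⟩
    obtain ⟨p, k, hp, hk, rfl⟩ := (isPrimePow_nat_iff q).1 hq
    rw [unitaryDvd_prime_pow_iff hp hk.ne' h0] at hqn
    refine ⟨p, ?_, by rw [hqn]⟩
    rw [← Nat.support_factorization, Finsupp.mem_support_iff, hqn]
    exact hk.ne'

theorem additive_eq_sum_unitaryDvd {M : Type*} [AddCommMonoid M] (f : ℕ → M)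
    (hf : ∀ m n : ℕ, 0 < m → 0 < n → m.Coprime n → f (m * n) = f m + f n) (hf1 : f 1 = 0)
    {n N : ℕ} (hn : n ∈ Icc 1 N) :
    f n = ∑ q ∈ Icc 1 N with IsPrimePow q ∧ UnitaryDvd q n, f q := by
  have h0 : n ≠ 0 := by have := (mem_Icc.1 hn).1; omega
  -- The multiplicative factorization is transported to an additive target. The argument 0 is
  -- harmless: coprimality with 0 forces the other argument to be 1, where `f` vanishes.
  have h := Nat.multiplicative_factorization (fun k => Multiplicative.ofAdd (f k)) (by
    intro x y hxy
    rcases Nat.eq_zero_or_pos x with rfl | hx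
    · simp only [Nat.coprime_zero_left] at hxy
      simp [hxy, hf1]
    rcases Nat.eq_zero_or_pos y with rfl | hy
    · simp only [Nat.coprime_zero_right] at hxy
      simp [hxy, hf1]
    exact congrArg Multiplicative.ofAdd (hf x y hx hy hxy)) (by simp [hf1]) h0
  rw [← image_primeFactors_ordProj hn, sum_image]
  · exact h
  · intro p hp p' hp' h
    have hpp := Nat.prime_of_mem_primeFactors hp
    have hpp' := Nat.prime_of_mem_primeFactors hp'
    have hk : n.factorization p ≠ 0 := by
      have := mem_coe.1 hp
      rwa [← Nat.support_factorization, Finsupp.mem_support_iff] at this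
    have h3 : p ∣ p' ^ n.factorization p' := by
      simp only at h
      rw [← h]; exact dvd_pow_self p hk
    exact (Nat.prime_dvd_prime_iff_eq hpp hpp').1 (hpp.dvd_of_dvd_pow h3)

/-- Substitute `n = q * m`: exact divisibility by `q` becomes coprimality of `q` and `m`, and `w`
splits. -/
theorem sum_unitaryDvd_eq {w : ℕ → ℝ} (hmul : ∀ m n : ℕ, m.Coprime n → w (m * n) = w m * w n)
    {q : ℕ} (hq : 0 < q) (N : ℕ) (F : ℕ → ℝ) :
    ∑ n ∈ Icc 1 N with UnitaryDvd q n, w n * F n =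
      w q * ∑ m ∈ Icc 1 N with q * m ≤ N ∧ q.Coprime m, w m * F (q * m) := by
  rw [mul_sum]
  symm
  refine sum_bij (fun m _ => q * m) ?_ ?_ ?_ ?_
  · intro m hm
    simp only [mem_filter, mem_Icc] at hm ⊢
    exact ⟨⟨Nat.mul_pos hq hm.1.1, hm.2.1⟩, (unitaryDvd_mul_right hq).2 hm.2.2⟩
  · intro a _ b _ h
    exact Nat.eq_of_mul_eq_mul_left hq h
  · intro n hn
    simp only [mem_filter, mem_Icc] at hn
    obtain ⟨⟨h1, h2⟩, ⟨m, rfl⟩, h4⟩ := hn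
    rw [Nat.mul_div_cancel_left m hq] at h4
    have hm : 1 ≤ m := Nat.pos_of_mul_pos_left h1 
    exact ⟨m, by
      simp only [mem_filter, mem_Icc]
      exact ⟨⟨hm, (Nat.le_mul_of_pos_left m hq).trans h2⟩, h2, h4⟩, rfl⟩
  · intro m hm
    simp only [mem_filter] at hm
    rw [hmul _ _ hm.2.2, mul_assoc]

/-! ### Chebyshev bounds for sums over primes. -/

theorem sum_log_div_prime_le_of_mem_block {s : Finset ℕ} (hs : ∀ p ∈ s, p.Prime) {u : ℝ}
    (hu : 0 < u) (h : ∀ p ∈ s, u ≤ p ∧ (p : ℝ) ≤ Real.exp 1 * u) :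
    ∑ p ∈ s, Real.log p / p ≤ Real.exp 1 * Real.log 4 := by
  have h1 : ∑ p ∈ s, Real.log p / p ≤ (∑ p ∈ s, Real.log p) / u := by
    rw [sum_div]
    refine sum_le_sum fun p hp => ?_
    exact div_le_div_of_nonneg_left (Real.log_natCast_nonneg p) hu (h p hp).1
  have h2 : ∑ p ∈ s, Real.log p ≤ Chebyshev.theta (Real.exp 1 * u) := by
    refine sum_le_sum_of_subset_of_nonneg ?_ fun p _ _ => Real.log_natCast_nonneg p
    intro p hp
    simp only [mem_filter, mem_Ioc]
    exact ⟨⟨(hs p hp).pos, Nat.le_floor (h p hp).2⟩, hs p hp⟩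
  have h3 := Chebyshev.theta_le_log4_mul_x (x := Real.exp 1 * u) (by positivity)
  refine h1.trans ((div_le_iff₀ hu).2 ?_)
  linarith

/-- Each block of ratio `e` contributes a bounded amount to the sum of `log p / p`, so a weight
constant on blocks turns a prime sum into a sum over block indices. -/
theorem sum_log_div_prime_mul_le {s : Finset ℕ} (hs : ∀ p ∈ s, p.Prime) (κ : ℕ → ℕ)
    (u : ℕ → ℝ) (hu : ∀ k, 0 < u k)
    (h : ∀ p ∈ s, u (κ p) ≤ p ∧ (p : ℝ) ≤ Real.exp 1 * u (κ p)) {K : ℕ}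
    (hK : ∀ p ∈ s, κ p < K) {φ : ℕ → ℝ} (hφ : ∀ k, 0 ≤ φ k) :
    ∑ p ∈ s, Real.log p / p * φ (κ p) ≤ Real.exp 1 * Real.log 4 * ∑ k ∈ range K, φ k := by
  rw [← sum_fiberwise_of_maps_to (t := range K) (g := κ) (fun p hp => mem_range.2 (hK p hp)),
    mul_sum]
  refine sum_le_sum fun k _ => ?_
  have h1 : ∑ p ∈ s with κ p = k, Real.log p / p * φ (κ p) =
      (∑ p ∈ s with κ p = k, Real.log p / p) * φ k := by
    rw [sum_mul]
    refine sum_congr rfl fun p hp => ?_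
    rw [(mem_filter.1 hp).2]
  rw [h1]
  refine mul_le_mul_of_nonneg_right ?_ (hφ k)
  refine sum_log_div_prime_le_of_mem_block (fun p hp => hs p (mem_filter.1 hp).1) (hu k) ?_
  intro p hp
  obtain ⟨h2, rfl⟩ := mem_filter.1 hp
  exact h p h2

theorem mem_exp_block_of_floor_log {t : ℝ} (ht : 1 ≤ t) :
    Real.exp ⌊Real.log t⌋₊ ≤ t ∧ t ≤ Real.exp 1 * Real.exp ⌊Real.log t⌋₊ := by
  have h0 : 0 < t := by linarith
  have h1 := Nat.floor_le (Real.log_nonneg ht)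
  have h2 := (Nat.lt_floor_add_one (Real.log t)).le
  constructor
  · exact (Real.le_log_iff_exp_le h0).1 h1
  · rw [← Real.exp_add, add_comm]
    exact (Real.log_le_iff_le_exp h0).1 h2

/-- Blocks counted downwards from `y`, for weights depending on `y / p`. -/
theorem mem_div_exp_block_of_floor_log {y p : ℝ} (hp : 0 < p) (hpy : p ≤ y) :
    y / Real.exp (⌊Real.log (y / p)⌋₊ + 1) ≤ p ∧
      p ≤ Real.exp 1 * (y / Real.exp (⌊Real.log (y / p)⌋₊ + 1)) := by
  obtain ⟨h1, h2⟩ := mem_exp_block_of_floor_log ((one_le_div hp).2 hpy)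
  rw [Real.exp_add]
  have he := Real.exp_pos (⌊Real.log (y / p)⌋₊ : ℝ)
  have he1 := Real.exp_pos 1
  rw [le_div_iff₀ hp] at h1
  rw [div_le_iff₀ hp] at h2
  constructor
  · rw [div_le_iff₀ (by positivity)]
    linarith
  · rw [mul_div_assoc', le_div_iff₀ (by positivity)]
    nlinarith

theorem sum_log_div_prime_le_of_short {s : Finset ℕ} (hs : ∀ p ∈ s, p.Prime) {y d : ℝ}
    (hd : 1 ≤ d) (h : ∀ p ∈ s, (p : ℝ) ≤ y ∧ y < d * p) :
    ∑ p ∈ s, Real.log p / p ≤ Real.exp 1 * Real.log 4 * (1 + Real.log d) := by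
  have hl : 0 < Real.log 4 := Real.log_pos (by norm_num)
  have hld : 0 ≤ Real.log d := Real.log_nonneg hd
  rcases s.eq_empty_or_nonempty with rfl | ⟨p₀, hp₀⟩
  · simp only [sum_empty]; positivity
  have hy : 0 < y := lt_of_lt_of_le (by exact_mod_cast (hs p₀ hp₀).pos) (h p₀ hp₀).1
  have h1 := sum_log_div_prime_mul_le hs (fun p => ⌊Real.log (y / p)⌋₊)
    (fun k => y / Real.exp (k + 1)) (fun k => by positivity)
    (fun p hp => mem_div_exp_block_of_floor_log (by exact_mod_cast (hs p hp).pos) (h p hp).1)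
    (K := ⌊Real.log d⌋₊ + 1) (fun p hp => by
      have hp0 : (0 : ℝ) < p := by exact_mod_cast (hs p hp).pos
      refine Nat.lt_succ_of_le (Nat.floor_le_floor (Real.log_le_log (by positivity) ?_))
      exact (div_le_iff₀ hp0).2 (h p hp).2.le) (φ := fun _ => 1) (fun _ => zero_le_one)
  simp only [mul_one, sum_const, card_range, nsmul_eq_mul] at h1
  refine h1.trans (mul_le_mul_of_nonneg_left ?_ (by positivity))
  push_cast
  linarith [Nat.floor_le hld]

theorem sum_one_div_sqrt_le (K : ℕ) :
    ∑ k ∈ range K, 1 / √((k : ℝ) + 1) ≤ 2 * √(K : ℝ) := by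
  induction K with
  | zero => simp
  | succ K ih =>
    rw [sum_range_succ]
    push_cast
    have h1 : 0 < √((K : ℝ) + 1) := Real.sqrt_pos.2 (by positivity)
    have h2 := Real.sq_sqrt (show (0 : ℝ) ≤ K + 1 by positivity)
    have h3 := Real.sq_sqrt (show (0 : ℝ) ≤ K by positivity)
    have h4 : 1 / √((K : ℝ) + 1) ≤ 2 * √((K : ℝ) + 1) - 2 * √(K : ℝ) := by
      rw [div_le_iff₀ h1]
      nlinarith [sq_nonneg (√((K : ℝ) + 1) - √(K : ℝ))]
    linarith

/-- On the `k`-th block below `N` the weight is at most `1 / √(k + 1)`, and these add up to the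
order of `√(1 + log N)`: the singularity at `p` near `N` is integrable. -/
theorem sum_log_div_prime_mul_inv_sqrt_log_div_le {N : ℕ} (hN : 1 ≤ N) :
    ∑ p ∈ Icc 1 N with p.Prime, Real.log p / p * (1 / √(1 + Real.log (N / p))) ≤
      Real.exp 1 * Real.log 4 * (2 * √(1 + Real.log N)) := by
  have hl : 0 < Real.log 4 := Real.log_pos (by norm_num)
  have hN0 : (0 : ℝ) < N := by exact_mod_cast hN
  have hpos : ∀ p ∈ (Icc 1 N).filter Nat.Prime, (1 : ℝ) ≤ p ∧ (p : ℝ) ≤ N := fun p hp => by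
    have := mem_Icc.1 (mem_filter.1 hp).1
    exact_mod_cast this
  have h1 := sum_log_div_prime_mul_le (s := (Icc 1 N).filter Nat.Prime)
    (fun p hp => (mem_filter.1 hp).2) (fun p => ⌊Real.log (N / p)⌋₊)
    (fun k => N / Real.exp (k + 1)) (fun k => by positivity)
    (fun p hp => mem_div_exp_block_of_floor_log (by linarith [hpos p hp]) (hpos p hp).2)
    (K := ⌊Real.log N⌋₊ + 1) (fun p hp => by
      have := (hpos p hp).1
      refine Nat.lt_succ_of_le (Nat.floor_le_floor (Real.log_le_log (by positivity) ?_))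
      exact div_le_self hN0.le this) (φ := fun k => 1 / √((k : ℝ) + 1)) (fun _ => by positivity)
  refine (le_trans ?_ h1).trans (mul_le_mul_of_nonneg_left ?_ (by positivity))
  · refine sum_le_sum fun p hp => mul_le_mul_of_nonneg_left ?_
      (div_nonneg (Real.log_natCast_nonneg p) (Nat.cast_nonneg p))
    have h3 : (1 : ℝ) ≤ N / p := (one_le_div (by linarith [hpos p hp])).2 (hpos p hp).2
    have h2 := Nat.floor_le (Real.log_nonneg h3)
    refine one_div_le_one_div_of_le (Real.sqrt_pos.2 (by positivity)) (Real.sqrt_le_sqrt ?_)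
    linarith
  · refine (sum_one_div_sqrt_le _).trans ?_
    have h2 := Nat.floor_le (Real.log_natCast_nonneg N)
    refine mul_le_mul_of_nonneg_left (Real.sqrt_le_sqrt ?_) (by norm_num)
    push_cast
    linarith

/-- The bound `1 / 2` suffices to absorb `1 + log p` into `3 * log p`. -/
theorem log_two_le_log_prime {p : ℕ} (hp : p.Prime) : 1 / 2 ≤ Real.log p := by
  have h2 : (2 : ℝ) ≤ p := by exact_mod_cast hp.two_le
  have := Real.log_le_log (by norm_num) h2
  linarith [Real.log_two_gt_d9]

theorem sum_log_div_prime_mul_inv_sqrt_log_le {N : ℕ} :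
    ∑ p ∈ Icc 1 N with p.Prime, Real.log p / p * (1 / √(Real.log p)) ≤
      Real.exp 1 * Real.log 4 * (4 * √(1 + Real.log N)) := by
  have hl : 0 < Real.log 4 := Real.log_pos (by norm_num)
  have hpos : ∀ p ∈ (Icc 1 N).filter Nat.Prime, (1 : ℝ) ≤ p ∧ (p : ℝ) ≤ N := fun p hp => by
    have := mem_Icc.1 (mem_filter.1 hp).1
    exact_mod_cast this
  have h1 := sum_log_div_prime_mul_le (s := (Icc 1 N).filter Nat.Prime)
    (fun p hp => (mem_filter.1 hp).2) (fun p => ⌊Real.log p⌋₊)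
    (fun k => Real.exp k) (fun k => by positivity)
    (fun p hp => mem_exp_block_of_floor_log (hpos p hp).1)
    (K := ⌊Real.log N⌋₊ + 1) (fun p hp => by
      have := (hpos p hp).1
      exact Nat.lt_succ_of_le (Nat.floor_le_floor (Real.log_le_log (by positivity) (hpos p hp).2)))
    (φ := fun k => 2 * (1 / √((k : ℝ) + 1))) (fun _ => by positivity)
  refine (le_trans ?_ h1).trans (mul_le_mul_of_nonneg_left ?_ (by positivity))
  · refine sum_le_sum fun p hp => mul_le_mul_of_nonneg_left ?_
      (div_nonneg (Real.log_natCast_nonneg p) (Nat.cast_nonneg p))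
    have h2 := Nat.floor_le (Real.log_natCast_nonneg p)
    have h3 := log_two_le_log_prime (mem_filter.1 hp).2
    have h4 : √((⌊Real.log p⌋₊ : ℝ) + 1) ≤ 2 * √(Real.log p) := by
      rw [Real.sqrt_le_left (by positivity), mul_pow, Real.sq_sqrt (by linarith)]
      linarith
    have h5 : 0 < √(Real.log p) := Real.sqrt_pos.2 (by linarith)
    rw [mul_one_div, div_le_div_iff₀ h5 (Real.sqrt_pos.2 (by positivity))]
    linarith
  · rw [← mul_sum]
    have h2 := Nat.floor_le (Real.log_natCast_nonneg N)
    have h3 : √((⌊Real.log N⌋₊ + 1 : ℕ) : ℝ) ≤ √(1 + Real.log N) := by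
      refine Real.sqrt_le_sqrt ?_
      push_cast
      linarith
    linarith [sum_one_div_sqrt_le (⌊Real.log N⌋₊ + 1)]

theorem sum_log_sq_div_cube_le (N : ℕ) :
    ∑ n ∈ Icc 1 N, Real.log n ^ 2 / (n : ℝ) ^ 3 ≤ 8 := by
  have h1 : ∑ n ∈ Icc 1 N, ((n : ℝ) ^ 2)⁻¹ ≤ 2 := by
    have := sum_Ioo_inv_sq_le (α := ℝ) 0 (N + 1)
    have h2 : Ioo 0 (N + 1) = Icc 1 N := by ext; simp; omega
    rw [h2] at this
    simpa using this
  have h2 : ∑ n ∈ Icc 1 N, Real.log n ^ 2 / (n : ℝ) ^ 3 ≤ ∑ n ∈ Icc 1 N, 4 * ((n : ℝ) ^ 2)⁻¹ := by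
    refine sum_le_sum fun n hn => ?_
    have hn1 : (1 : ℝ) ≤ n := by exact_mod_cast (mem_Icc.1 hn).1
    -- This reduces the series to that of `4 / n ^ 2`.
    have h3 : Real.log n ≤ 2 * √n := by
      have h4 := Real.log_le_sub_one_of_pos (x := √n) (Real.sqrt_pos.2 (by linarith))
      rw [Real.log_sqrt (by linarith)] at h4
      linarith
    have h5 : Real.log n ^ 2 ≤ 4 * n := by
      have := pow_le_pow_left₀ (Real.log_natCast_nonneg n) h3 2
      rw [mul_pow, Real.sq_sqrt (by linarith)] at this
      linarith
    have h6 : (4 : ℝ) * ((n : ℝ) ^ 2)⁻¹ = 4 * n / (n : ℝ) ^ 3 := by field_simp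
    rw [h6]
    exact div_le_div_of_nonneg_right h5 (by positivity)
  rw [← mul_sum] at h2
  linarith

/-! ### Logarithmic weights and their sums over short ranges. -/

/-- A nonnegative function, multiplicative on coprime arguments, that is at most `A / p` on the
primes `p ≤ N` and whose logarithmic sum over the proper prime powers up to `N` is at most `B`. -/
structure IsLogWeight (N : ℕ) (A B : ℝ) (w : ℕ → ℝ) : Prop where
  nonneg : ∀ n, 0 ≤ w n
  mul : ∀ m n : ℕ, m.Coprime n → w (m * n) = w m * w n
  prime_le : ∀ p : ℕ, p.Prime → p ≤ N → w p ≤ A / p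
  sum_le : ∑ q ∈ Icc 1 N with IsPrimePow q ∧ ¬ q.Prime, w q * Real.log q ≤ B
  nonneg_left : 0 ≤ A

/-- The sum of `w q * log q` over the powers `q ≤ N` of the prime `p`. -/
noncomputable def localLogSum (w : ℕ → ℝ) (N p : ℕ) : ℝ :=
  ∑ q ∈ Icc 1 N with IsPrimePow q ∧ p ∣ q, w q * Real.log q

namespace IsLogWeight

variable {N : ℕ} {A B : ℝ} {w : ℕ → ℝ}

theorem nonneg_right (h : IsLogWeight N A B w) : 0 ≤ B :=
  (sum_nonneg fun q _ => mul_nonneg (h.nonneg q) (Real.log_natCast_nonneg q)).trans h.sum_le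

theorem localLogSum_nonneg (h : IsLogWeight N A B w) (p : ℕ) : 0 ≤ localLogSum w N p :=
  sum_nonneg fun q _ => mul_nonneg (h.nonneg q) (Real.log_natCast_nonneg q)

/-- Expand `log n` over the prime powers exactly dividing `n` and exchange summations with `n = q *
m`. -/
theorem sum_mul_log_eq (h : IsLogWeight N A B w) (F : ℕ → ℝ) :
    ∑ n ∈ Icc 1 N, w n * (Real.log n * F n) =
      ∑ q ∈ Icc 1 N with IsPrimePow q,
        w q * Real.log q * ∑ m ∈ Icc 1 N with q * m ≤ N ∧ q.Coprime m, w m * F (q * m) := by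
  have h1 : ∀ n ∈ Icc 1 N, w n * (Real.log n * F n) =
      ∑ q ∈ Icc 1 N with IsPrimePow q, if UnitaryDvd q n then Real.log q * (w n * F n) else 0 := by
    intro n hn
    have h2 := additive_eq_sum_unitaryDvd (fun k : ℕ => Real.log k) (fun a b ha hb _ => by
      simp only [Nat.cast_mul]
      exact Real.log_mul (by positivity) (by positivity)) (by simp) hn
    rw [← sum_filter, filter_filter]
    rw [h2, ← sum_mul, sum_mul, mul_sum, sum_mul]
    exact sum_congr rfl fun _ _ => by ring
  rw [sum_congr rfl h1, sum_comm]
  refine sum_congr rfl fun q hq => ?_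
  rw [← sum_filter, ← mul_sum,
    sum_unitaryDvd_eq h.mul (Nat.lt_of_succ_le (mem_Icc.1 (mem_filter.1 hq).1).1)]
  ring

/-- For fixed `m`, `q` runs over `y / (d m) < q ≤ y / m`. Chebyshev controls the primes there, and
`B` controls all proper prime powers at once. -/
theorem sum_mul_log_short_le (h : IsLogWeight N A B w) {d : ℝ} (hd : 1 ≤ d) (y : ℝ) {m : ℕ}
    (hm : 0 < m) :
    ∑ q ∈ Icc 1 N with IsPrimePow q ∧ (((q * m : ℕ) : ℝ) ≤ y ∧ y < d * (q * m : ℕ)),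
      w q * Real.log q ≤ (Real.exp 1 * Real.log 4 * A + B) * (1 + Real.log d) := by
  have hm0 : (0 : ℝ) < m := by exact_mod_cast hm
  have hld : 0 ≤ Real.log d := Real.log_nonneg hd
  have hB := h.nonneg_right
  rw [← sum_filter_add_sum_filter_not _ Nat.Prime]
  have h1 : ∑ q ∈ {q ∈ Icc 1 N | IsPrimePow q ∧ (((q * m : ℕ) : ℝ) ≤ y ∧ y < d * (q * m : ℕ))}
      with q.Prime, w q * Real.log q ≤ A * (Real.exp 1 * Real.log 4 * (1 + Real.log d)) := by
    refine le_trans ?_ (mul_le_mul_of_nonneg_left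
      (sum_log_div_prime_le_of_short (s := {q ∈ {q ∈ Icc 1 N |
        IsPrimePow q ∧ (((q * m : ℕ) : ℝ) ≤ y ∧ y < d * (q * m : ℕ))} | q.Prime})
        (y := y / m) ?_ hd ?_) h.nonneg_left)
    · rw [mul_sum]
      refine sum_le_sum fun q hq => ?_
      simp only [mem_filter, mem_Icc] at hq
      have := mul_le_mul_of_nonneg_right (h.prime_le q hq.2 hq.1.1.2) (Real.log_natCast_nonneg q)
      refine this.trans (le_of_eq (by ring))
    · exact fun p hp => (mem_filter.1 hp).2
    · intro p hp
      have := (mem_filter.1 (mem_filter.1 hp).1).2.2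
      push_cast at this
      rw [le_div_iff₀ hm0, div_lt_iff₀ hm0]
      exact ⟨this.1, by linarith [this.2]⟩
  have h2 : ∑ q ∈ {q ∈ Icc 1 N | IsPrimePow q ∧ (((q * m : ℕ) : ℝ) ≤ y ∧ y < d * (q * m : ℕ))}
      with ¬ q.Prime, w q * Real.log q ≤ B := by
    refine le_trans (sum_le_sum_of_subset_of_nonneg ?_ fun q _ _ =>
      mul_nonneg (h.nonneg q) (Real.log_natCast_nonneg q)) h.sum_le
    intro q hq
    simp only [mem_filter] at hq ⊢
    exact ⟨hq.1.1, hq.1.2.1, hq.2⟩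
  nlinarith [mul_nonneg hB hld]

theorem sum_filter_le_sum (h : IsLogWeight N A B w) (P : ℕ → Prop) [DecidablePred P] :
    ∑ n ∈ Icc 1 N with P n, w n ≤ ∑ n ∈ Icc 1 N, w n :=
  sum_le_sum_of_subset_of_nonneg (filter_subset _ _) fun n _ _ => h.nonneg n

theorem sum_nonneg' (h : IsLogWeight N A B w) (s : Finset ℕ) : 0 ≤ ∑ n ∈ s, w n :=
  sum_nonneg fun n _ => h.nonneg n

/-- Interchange of summation behind the estimates for short logarithmic sums. -/
theorem sum_prod_short_le (h : IsLogWeight N A B w) {d : ℝ} (hd : 1 ≤ d) (y : ℝ)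
    (P : ℕ → Prop) [DecidablePred P] :
    ∑ q ∈ Icc 1 N with IsPrimePow q, w q * Real.log q * ∑ m ∈ Icc 1 N with
      q * m ≤ N ∧ q.Coprime m,
        w m * (if P m ∧ ((q * m : ℕ) : ℝ) ≤ y ∧ y < d * (q * m : ℕ) then 1 else 0) ≤
      (Real.exp 1 * Real.log 4 * A + B) * (1 + Real.log d) * ∑ m ∈ Icc 1 N with P m, w m := by
  have h1 : ∀ q ∈ (Icc 1 N).filter IsPrimePow, w q * Real.log q * ∑ m ∈ Icc 1 N with
      q * m ≤ N ∧ q.Coprime m,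
        w m * (if P m ∧ ((q * m : ℕ) : ℝ) ≤ y ∧ y < d * (q * m : ℕ) then 1 else 0) ≤
      ∑ m ∈ Icc 1 N with P m,
        if ((q * m : ℕ) : ℝ) ≤ y ∧ y < d * (q * m : ℕ) then w q * Real.log q * w m else 0 := by
    intro q _
    have hq := mul_nonneg (h.nonneg q) (Real.log_natCast_nonneg q)
    rw [mul_sum, sum_filter (p := P)]
    refine (sum_le_sum_of_subset_of_nonneg (filter_subset _ _) fun m _ _ => ?_).trans
      (le_of_eq (sum_congr rfl fun m _ => ?_))
    · have := h.nonneg m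
      split_ifs <;> simp [mul_nonneg, *]
    · by_cases hP : P m <;> simp [hP]
  refine (sum_le_sum h1).trans ?_
  rw [sum_comm, mul_sum]
  refine sum_le_sum fun m hm => ?_
  rw [← sum_filter, filter_filter, ← sum_mul]
  exact mul_le_mul_of_nonneg_right (h.sum_mul_log_short_le hd y
    (Nat.lt_of_succ_le (mem_Icc.1 (mem_filter.1 hm).1).1)) (h.nonneg m)

theorem sum_short_mul_log_le (h : IsLogWeight N A B w) {d : ℝ} (hd : 1 ≤ d) (y : ℝ) :
    ∑ n ∈ Icc 1 N with ((n : ℕ) : ℝ) ≤ y ∧ y < d * n, w n * Real.log n ≤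
      (Real.exp 1 * Real.log 4 * A + B) * (1 + Real.log d) * ∑ n ∈ Icc 1 N, w n := by
  have h1 := h.sum_mul_log_eq (fun n => if ((n : ℕ) : ℝ) ≤ y ∧ y < d * n then 1 else 0)
  have h2 := h.sum_prod_short_le hd y (fun _ => True)
  simp only [true_and, filter_true] at h2
  rw [← h1] at h2
  refine le_trans (le_of_eq ?_) h2
  rw [sum_filter]
  exact sum_congr rfl fun n _ => by split_ifs <;> ring

/-- If `p` divides `q * m`, then either `p ∣ m`, which gives the first term, or `q` is a power of
`p`, which gives the second. -/
theorem sum_dvd_short_mul_log_le (h : IsLogWeight N A B w) {d : ℝ} (hd : 1 ≤ d) (y : ℝ)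
    {p : ℕ} (hp : p.Prime) :
    ∑ n ∈ Icc 1 N with p ∣ n ∧ ((n : ℕ) : ℝ) ≤ y ∧ y < d * n, w n * Real.log n ≤
      (Real.exp 1 * Real.log 4 * A + B) * (1 + Real.log d) * ∑ n ∈ Icc 1 N with p ∣ n, w n +
        localLogSum w N p * ∑ n ∈ Icc 1 N, w n := by
  have h1 := h.sum_mul_log_eq (fun n => if p ∣ n ∧ ((n : ℕ) : ℝ) ≤ y ∧ y < d * n then 1 else 0)
  have h2 := h.sum_prod_short_le hd y (fun m => p ∣ m)
  have h3 : ∑ n ∈ Icc 1 N with p ∣ n ∧ ((n : ℕ) : ℝ) ≤ y ∧ y < d * n, w n * Real.log n =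
      ∑ n ∈ Icc 1 N, w n * (Real.log n *
        (if p ∣ n ∧ ((n : ℕ) : ℝ) ≤ y ∧ y < d * n then 1 else 0)) := by
    rw [sum_filter]
    exact sum_congr rfl fun n _ => by split_ifs <;> ring
  rw [h3, h1]
  refine le_trans ?_ (add_le_add_left h2 _)
  rw [localLogSum, ← filter_filter, sum_filter (p := fun q => p ∣ q), sum_mul, ← sum_add_distrib]
  refine sum_le_sum fun q _ => ?_
  have hq := mul_nonneg (h.nonneg q) (Real.log_natCast_nonneg q)
  by_cases hpq : p ∣ q
  · rw [if_pos hpq]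
    have h5 : ∑ m ∈ Icc 1 N with q * m ≤ N ∧ q.Coprime m, w m * (if p ∣ q * m ∧
        ((q * m : ℕ) : ℝ) ≤ y ∧ y < d * (q * m : ℕ) then 1 else 0) ≤ ∑ n ∈ Icc 1 N, w n := by
      refine (sum_le_sum (g := w) fun m _ => ?_).trans (h.sum_filter_le_sum _)
      have := h.nonneg m
      split_ifs <;> simp [this]
    refine (mul_le_mul_of_nonneg_left h5 hq).trans (le_add_of_nonneg_left (mul_nonneg hq ?_))
    refine sum_nonneg fun m _ => mul_nonneg (h.nonneg m) ?_
    split_ifs <;> simp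
  · rw [if_neg hpq, zero_mul, add_zero]
    simp only [hp.dvd_mul, hpq, false_or, le_refl]

/-- A multiple of `p` is counted on the right at its exact power of `p`. -/
theorem sum_dvd_le (h : IsLogWeight N A B w) {p : ℕ} (hp : p.Prime) {F : ℕ → ℝ}
    (hF : ∀ n, 0 ≤ F n) :
    ∑ n ∈ Icc 1 N with p ∣ n, w n * F n ≤ ∑ q ∈ Icc 1 N with IsPrimePow q ∧ p ∣ q,
      w q * ∑ m ∈ Icc 1 N with q * m ≤ N ∧ q.Coprime m, w m * F (q * m) := by
  have h1 : ∀ q ∈ {q ∈ Icc 1 N | IsPrimePow q ∧ p ∣ q},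
      w q * ∑ m ∈ Icc 1 N with q * m ≤ N ∧ q.Coprime m, w m * F (q * m) =
        ∑ n ∈ Icc 1 N, if UnitaryDvd q n then w n * F n else 0 := fun q hq => by
    rw [← sum_filter, sum_unitaryDvd_eq h.mul
      (Nat.lt_of_succ_le (mem_Icc.1 (mem_filter.1 hq).1).1)]
  rw [sum_congr rfl h1, sum_comm, sum_filter]
  refine sum_le_sum fun n hn => ?_
  have hwF := mul_nonneg (h.nonneg n) (hF n)
  have hnn : ∀ q ∈ {q ∈ Icc 1 N | IsPrimePow q ∧ p ∣ q},
      0 ≤ if UnitaryDvd q n then w n * F n else 0 := fun q _ => by split_ifs <;> simp [hwF]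
  split_ifs with hpn
  · obtain ⟨hn1, hn2⟩ := mem_Icc.1 hn
    have hn0 : n ≠ 0 := by omega
    have hk : n.factorization p ≠ 0 := (hp.factorization_pos_of_dvd hn0 hpn).ne'
    have h2 := single_le_sum hnn (a := p ^ n.factorization p) (by
      simp only [mem_filter, mem_Icc]
      exact ⟨⟨Nat.one_le_pow _ _ hp.pos, (Nat.ordProj_le p hn0).trans hn2⟩,
        hp.isPrimePow.pow hk, dvd_pow_self p hk⟩)
    rwa [if_pos ((unitaryDvd_prime_pow_iff hp hk hn0).2 rfl)] at h2
  · exact sum_nonneg hnn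

theorem sum_primePow_dvd_le (h : IsLogWeight N A B w) (p : ℕ) :
    ∑ q ∈ Icc 1 N with IsPrimePow q ∧ p ∣ q, w q ≤ 2 * localLogSum w N p := by
  rw [localLogSum, mul_sum]
  refine sum_le_sum fun q hq => ?_
  have hq2 : (2 : ℝ) ≤ q := by exact_mod_cast (mem_filter.1 hq).2.1.two_le
  have h1 := Real.log_le_log (by norm_num) hq2
  have h2 := Real.log_two_gt_d9
  nlinarith [h.nonneg q]

theorem sum_dvd_le_localLogSum (h : IsLogWeight N A B w) {p : ℕ} (hp : p.Prime) :
    ∑ n ∈ Icc 1 N with p ∣ n, w n ≤ 2 * localLogSum w N p * ∑ n ∈ Icc 1 N, w n := by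
  have h1 := h.sum_dvd_le hp (F := fun _ => 1) (fun _ => zero_le_one)
  simp only [mul_one] at h1
  refine h1.trans ?_
  refine (sum_le_sum fun q _ =>
    mul_le_mul_of_nonneg_left (h.sum_filter_le_sum _) (h.nonneg q)).trans ?_
  rw [← sum_mul]
  exact mul_le_mul_of_nonneg_right (h.sum_primePow_dvd_le p) (h.sum_nonneg' _)

theorem sum_dvd_dvd_le (h : IsLogWeight N A B w) {p r : ℕ} (hp : p.Prime) (hr : r.Prime)
    (hpr : p ≠ r) :
    ∑ n ∈ Icc 1 N with p ∣ n ∧ r ∣ n, w n ≤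
      4 * (localLogSum w N p * localLogSum w N r) * ∑ n ∈ Icc 1 N, w n := by
  have h1 := h.sum_dvd_le hp (F := fun n => if r ∣ n then 1 else 0)
    (fun n => by split_ifs <;> simp)
  rw [← filter_filter, sum_filter]
  simp only [mul_ite, mul_one, mul_zero] at h1
  refine h1.trans ?_
  have h2 : ∀ q ∈ {q ∈ Icc 1 N | IsPrimePow q ∧ p ∣ q}, w q * ∑ m ∈ Icc 1 N with
      q * m ≤ N ∧ q.Coprime m, (if r ∣ q * m then w m else 0) ≤
      w q * ∑ m ∈ Icc 1 N with r ∣ m, w m := by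
    intro q hq
    obtain ⟨-, hq1, hq2⟩ := mem_filter.1 hq
    refine mul_le_mul_of_nonneg_left ?_ (h.nonneg q)
    rw [sum_filter (p := fun m => r ∣ m)]
    have hrq : ¬ r ∣ q := fun hrq =>
      hpr ((isPrimePow_iff_unique_prime_dvd.1 hq1).unique ⟨hp, hq2⟩ ⟨hr, hrq⟩)
    simp only [hr.dvd_mul, hrq, false_or]
    refine sum_le_sum_of_subset_of_nonneg (filter_subset _ _) fun m _ _ => ?_
    split_ifs <;> simp [h.nonneg m]
  refine (sum_le_sum h2).trans ?_
  rw [← sum_mul]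
  have h3 := h.sum_dvd_le_localLogSum hr
  have h4 := h.sum_primePow_dvd_le p
  have h5 := h.localLogSum_nonneg p
  refine (mul_le_mul h4 h3 (h.sum_nonneg' _) (by positivity)).trans (le_of_eq (by ring))

/-- On the range, `log n ≥ log y - log d`, so the factor `1 + log y` is at most `(1 + log d) + log
n`. -/
theorem sum_short_le (h : IsLogWeight N A B w) {d y : ℝ} (hd : 1 ≤ d) (hy : 1 ≤ y) :
    (1 + Real.log y) * ∑ n ∈ Icc 1 N with ((n : ℕ) : ℝ) ≤ y ∧ y < d * n, w n ≤
      (1 + Real.exp 1 * Real.log 4 * A + B) * (1 + Real.log d) * ∑ n ∈ Icc 1 N, w n := by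
  have h1 := h.sum_short_mul_log_le hd y
  have h2 : (1 + Real.log y) * ∑ n ∈ Icc 1 N with ((n : ℕ) : ℝ) ≤ y ∧ y < d * n, w n ≤
      (1 + Real.log d) * ∑ n ∈ Icc 1 N with ((n : ℕ) : ℝ) ≤ y ∧ y < d * n, w n +
      ∑ n ∈ Icc 1 N with ((n : ℕ) : ℝ) ≤ y ∧ y < d * n, w n * Real.log n := by
    rw [mul_sum, mul_sum, ← sum_add_distrib]
    refine sum_le_sum fun n hn => ?_
    simp only [mem_filter, mem_Icc] at hn
    have hn1 : (1 : ℝ) ≤ n := by exact_mod_cast hn.1.1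
    have h3 := Real.log_le_log (by linarith) hn.2.2.le
    rw [Real.log_mul (by linarith) (by linarith)] at h3
    nlinarith [h.nonneg n]
  have h3 := mul_le_mul_of_nonneg_left
    (h.sum_filter_le_sum (fun n => ((n : ℕ) : ℝ) ≤ y ∧ y < d * n))
    (show 0 ≤ 1 + Real.log d by linarith [Real.log_nonneg hd])
  linarith

theorem sum_dvd_short_le (h : IsLogWeight N A B w) {d y : ℝ} (hd : 1 ≤ d) (hy : 1 ≤ y)
    {p : ℕ} (hp : p.Prime) :
    (1 + Real.log y) * ∑ n ∈ Icc 1 N with p ∣ n ∧ ((n : ℕ) : ℝ) ≤ y ∧ y < d * n, w n ≤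
      3 * (1 + Real.exp 1 * Real.log 4 * A + B) * (1 + Real.log d) * localLogSum w N p *
        ∑ n ∈ Icc 1 N, w n := by
  have h1 := h.sum_dvd_short_mul_log_le hd y hp
  have hld := Real.log_nonneg hd
  have h2 : (1 + Real.log y) *
      ∑ n ∈ Icc 1 N with p ∣ n ∧ ((n : ℕ) : ℝ) ≤ y ∧ y < d * n, w n ≤
      (1 + Real.log d) * ∑ n ∈ Icc 1 N with p ∣ n ∧ ((n : ℕ) : ℝ) ≤ y ∧ y < d * n, w n +
      ∑ n ∈ Icc 1 N with p ∣ n ∧ ((n : ℕ) : ℝ) ≤ y ∧ y < d * n, w n * Real.log n := by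
    rw [mul_sum, mul_sum, ← sum_add_distrib]
    refine sum_le_sum fun n hn => ?_
    simp only [mem_filter, mem_Icc] at hn
    have hn1 : (1 : ℝ) ≤ n := by exact_mod_cast hn.1.1
    have h3 := Real.log_le_log (by linarith) hn.2.2.2.le
    rw [Real.log_mul (by linarith) (by linarith)] at h3
    nlinarith [h.nonneg n]
  have h3 : ∑ n ∈ Icc 1 N with p ∣ n ∧ ((n : ℕ) : ℝ) ≤ y ∧ y < d * n, w n ≤
      ∑ n ∈ Icc 1 N with p ∣ n, w n := by
    rw [← filter_filter]
    exact sum_le_sum_of_subset_of_nonneg (filter_subset _ _) fun n _ _ => h.nonneg n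
  have h4 := h.sum_dvd_le_localLogSum hp
  have h5 := mul_le_mul_of_nonneg_left (h3.trans h4) (show 0 ≤ 1 + Real.log d by linarith)
  have hl : 0 < Real.log 4 := Real.log_pos (by norm_num)
  have hA := h.nonneg_left
  have hB := h.nonneg_right
  have hκ : 0 ≤ Real.exp 1 * Real.log 4 * A + B := by positivity
  have h6 := mul_le_mul_of_nonneg_left h4
    (mul_nonneg hκ (show 0 ≤ 1 + Real.log d by linarith))
  have h7 : 0 ≤ localLogSum w N p * ∑ n ∈ Icc 1 N, w n :=
    mul_nonneg (h.localLogSum_nonneg p) (h.sum_nonneg' _)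
  have h8 : localLogSum w N p * ∑ n ∈ Icc 1 N, w n ≤
    (1 + Real.exp 1 * Real.log 4 * A + B) * (1 + Real.log d) *
      (localLogSum w N p * ∑ n ∈ Icc 1 N, w n) := by
    refine le_mul_of_one_le_left h7 ?_
    nlinarith [mul_nonneg hκ hld]
  linarith

end IsLogWeight

/-! ### The covariance kernel and its separation of variables. -/

/-- Used with `a = log p`, `b = log r`, `l = 1 + log (N / r)`: the bound by `a / l` is bad for `r`
near `N`, so it is interpolated with `T ≤ S`. The exponent `1 / 4` leaves `(L / l) ^ (1 / 2)` in the
squared factor, whose sum over primes is bounded; exponent `1 / 2` would leave `L / l` and lose a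
logarithm. -/
theorem le_sqrt_mul_sqrt_add_of_mul_le {T S c a b L l : ℝ} (hT : 0 ≤ T) (hTS : T ≤ S)
    (hc : 1 ≤ c) (h : l * T ≤ c * a * S) (ha : 0 < a) (hab : a ≤ b) (hl : 1 ≤ l)
    (hL : l + b = L) :
    T ≤ 2 * c * S * (√(a / L) * √(b / L) + √√(a / L) * √(b / L * √(L / l))) := by
  have hS : 0 ≤ S := hT.trans hTS
  have hL0 : 0 < L := by linarith
  have hl0 : 0 < l := by linarith
  have hb : 0 < b := by linarith
  rcases le_total (L / 2) l with h1 | h1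
  · have h2 : a / L ≤ √(a / L) * √(b / L) := by
      calc a / L = √(a / L) * √(a / L) := (Real.mul_self_sqrt (by positivity)).symm
        _ ≤ _ := by gcongr
    have h3 : T ≤ 2 * c * S * (a / L) := by
      rw [mul_div_assoc', le_div_iff₀ hL0]
      nlinarith
    exact h3.trans (mul_le_mul_of_nonneg_left (h2.trans (le_add_of_nonneg_right (by positivity)))
      (by positivity))
  -- Here `l` is at most `L / 2`, so `b` is comparable to `L` and the factor `√(b / L)` can be
  -- inserted at the cost of a factor 2.
  · have h2 : 1 / 4 ≤ b / L := by
      rw [div_le_div_iff₀ (by norm_num) hL0]; linarith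
    have h3 : 1 / 2 ≤ √(b / L) := Real.le_sqrt_of_sq_le (by linarith)
    have h4 : T ≤ c * S * √√(a / l) := by
      rcases le_total 1 (a / l) with h5 | h5
      · have h6 : 1 ≤ √√(a / l) := by simpa using h5
        have h7 : S * 1 ≤ S * (c * √√(a / l)) := by
          refine mul_le_mul_of_nonneg_left ?_ hS
          nlinarith
        linarith
      · have h5' : 0 ≤ a / l := by positivity
        have h6 : a / l ≤ √√(a / l) :=
          Real.le_sqrt_of_sq_le (Real.le_sqrt_of_sq_le (by
            rw [← pow_mul]
            exact pow_le_of_le_one h5' h5 (by norm_num)))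
        have h7 : T ≤ c * S * (a / l) := by
          rw [mul_div_assoc', le_div_iff₀ hl0]
          linarith
        exact h7.trans (mul_le_mul_of_nonneg_left h6 (by positivity))
    have h5 : √√(a / l) = √√(a / L) * √√(L / l) := by
      rw [← Real.sqrt_mul (by positivity), ← Real.sqrt_mul (by positivity)]
      congr 2
      field_simp
    have h6 : √(b / L * √(L / l)) = √(b / L) * √√(L / l) := Real.sqrt_mul (by positivity) _
    have h7 : √√(a / l) ≤ 2 * (√√(a / L) * √(b / L * √(L / l))) := by
      rw [h5, h6]
      have : 0 ≤ √√(a / L) * √√(L / l) := by positivity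
      nlinarith
    have h8 : 0 ≤ √(a / L) * √(b / L) := by positivity
    have h9 : 0 ≤ c * S := by positivity
    nlinarith [mul_le_mul_of_nonneg_left h7 h9, mul_nonneg h9 h8]

/-- The normalised covariance of the indicators of `p ∥ n` and `r ∥ n`, for primes `p ≠ r`. -/
noncomputable def covarianceKernel (w : ℕ → ℝ) (N p r : ℕ) : ℝ :=
  ∑ n ∈ Icc 1 N, w n * ((if p * (r * n) ≤ N ∧ p.Coprime n ∧ r.Coprime n then 1 else 0) -
    (if p * n ≤ N ∧ p.Coprime n then 1 else 0) - (if r * n ≤ N ∧ r.Coprime n then 1 else 0) + 1)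

/-- The indicator of `p ∥ n`, centred at its expected value `w p`. -/
noncomputable def centredIndicator (w : ℕ → ℝ) (p n : ℕ) : ℝ :=
  (if UnitaryDvd p n then 1 else 0) - w p

theorem covarianceKernel_comm (w : ℕ → ℝ) (N p r : ℕ) :
    covarianceKernel w N p r = covarianceKernel w N r p := by
  refine sum_congr rfl fun n _ => ?_
  simp only [mul_left_comm p r n, and_comm (a := p.Coprime n)]
  ring

namespace IsLogWeight

variable {N : ℕ} {A B : ℝ} {w : ℕ → ℝ}

theorem sum_unitaryDvd (h : IsLogWeight N A B w) {q : ℕ} (hq : 0 < q) :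
    ∑ n ∈ Icc 1 N, w n * (if UnitaryDvd q n then 1 else 0) =
      w q * ∑ n ∈ Icc 1 N, w n * (if q * n ≤ N ∧ q.Coprime n then 1 else 0) := by
  have h1 := sum_unitaryDvd_eq h.mul hq N (fun _ => 1)
  simpa [sum_filter] using h1

theorem sum_unitaryDvd_mul (h : IsLogWeight N A B w) {q r : ℕ} (hq : 0 < q) (hr : 0 < r)
    (hqr : q.Coprime r) :
    ∑ n ∈ Icc 1 N, w n * ((if UnitaryDvd q n then 1 else 0) * (if UnitaryDvd r n then 1 else 0)) =
      w q * w r * ∑ n ∈ Icc 1 N,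
        w n * (if q * (r * n) ≤ N ∧ q.Coprime n ∧ r.Coprime n then 1 else 0) := by
  have h1 := sum_unitaryDvd_eq h.mul hq N (fun n => if UnitaryDvd r n then 1 else 0)
  have h2 := sum_unitaryDvd_eq h.mul hr N (fun n => if q * n ≤ N ∧ q.Coprime n then 1 else 0)
  simp only [unitaryDvd_mul_left_iff hqr] at h1
  have h3 : ∑ m ∈ Icc 1 N with q * m ≤ N ∧ q.Coprime m, w m * (if UnitaryDvd r m then 1 else 0) =
      ∑ n ∈ Icc 1 N with UnitaryDvd r n, w n * (if q * n ≤ N ∧ q.Coprime n then 1 else 0) := by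
    rw [sum_filter, sum_filter]
    refine sum_congr rfl fun m _ => ?_
    split_ifs <;> simp
  rw [h3, h2, sum_filter] at h1
  rw [mul_assoc]
  refine Eq.trans ?_ (h1.trans ?_)
  · refine sum_congr rfl fun m _ => ?_
    split_ifs <;> simp
  · rw [sum_filter]
    congr 2
    refine sum_congr rfl fun m _ => ?_
    have h4 : q * (r * m) ≤ N → r * m ≤ N := (Nat.le_mul_of_pos_left _ hq).trans
    have h5 : q.Coprime (r * m) ↔ q.Coprime m :=
      Nat.coprime_mul_iff_right.trans (and_iff_right hqr)
    split_ifs <;> first | rfl | (exfalso; tauto) | simp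

theorem sum_centredIndicator_mul (h : IsLogWeight N A B w) {p r : ℕ} (hp : 0 < p) (hr : 0 < r)
    (hpr : p.Coprime r) :
    ∑ n ∈ Icc 1 N, w n * (centredIndicator w p n * centredIndicator w r n) =
      w p * w r * covarianceKernel w N p r := by
  have h1 := h.sum_unitaryDvd_mul hp hr hpr
  have h2 := h.sum_unitaryDvd hp
  have h3 := h.sum_unitaryDvd hr
  have h4 : ∑ n ∈ Icc 1 N, w n * (centredIndicator w p n * centredIndicator w r n) =
      ∑ n ∈ Icc 1 N, w n * ((if UnitaryDvd p n then 1 else 0) * (if UnitaryDvd r n then 1 else 0)) -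
      w r * ∑ n ∈ Icc 1 N, w n * (if UnitaryDvd p n then 1 else 0) -
      w p * ∑ n ∈ Icc 1 N, w n * (if UnitaryDvd r n then 1 else 0) +
      w p * w r * ∑ n ∈ Icc 1 N, w n := by
    simp only [mul_sum, ← sum_sub_distrib, ← sum_add_distrib, centredIndicator]
    exact sum_congr rfl fun n _ => by ring
  have h5 : covarianceKernel w N p r =
      ∑ n ∈ Icc 1 N, w n * (if p * (r * n) ≤ N ∧ p.Coprime n ∧ r.Coprime n then 1 else 0) -
      ∑ n ∈ Icc 1 N, w n * (if p * n ≤ N ∧ p.Coprime n then 1 else 0) -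
      ∑ n ∈ Icc 1 N, w n * (if r * n ≤ N ∧ r.Coprime n then 1 else 0) +
      ∑ n ∈ Icc 1 N, w n := by
    simp only [← sum_sub_distrib, ← sum_add_distrib, covarianceKernel]
    exact sum_congr rfl fun n _ => by ring
  rw [h4, h1, h2, h3, h5]
  ring

theorem sum_centredIndicator_sq_le (h : IsLogWeight N A B w) {p : ℕ} (hp : p.Prime) (hpN : p ≤ N) :
    ∑ n ∈ Icc 1 N, w n * (centredIndicator w p n * centredIndicator w p n) ≤
      (1 + A) * (w p * ∑ n ∈ Icc 1 N, w n) := by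
  have h1 := h.sum_unitaryDvd hp.pos
  have h2 : ∑ n ∈ Icc 1 N, w n * (if p * n ≤ N ∧ p.Coprime n then 1 else 0) ≤
      ∑ n ∈ Icc 1 N, w n :=
    sum_le_sum fun n _ => by have := h.nonneg n; split_ifs <;> simp [this]
  have h3 : ∑ n ∈ Icc 1 N, w n * (centredIndicator w p n * centredIndicator w p n) ≤
      ∑ n ∈ Icc 1 N, w n * (if UnitaryDvd p n then 1 else 0) + w p ^ 2 * ∑ n ∈ Icc 1 N, w n := by
    rw [mul_sum, ← sum_add_distrib]
    refine sum_le_sum fun n _ => ?_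
    have hn := h.nonneg n
    have hp := h.nonneg p
    have := mul_nonneg hn hp
    unfold centredIndicator
    split_ifs <;> nlinarith
  have h4 : w p ≤ A := (h.prime_le p hp hpN).trans
    (div_le_self h.nonneg_left (by exact_mod_cast hp.one_le))
  have h5 := mul_le_mul_of_nonneg_left h2 (h.nonneg p)
  have h6 := mul_le_mul_of_nonneg_right h4 (mul_nonneg (h.nonneg p) (h.sum_nonneg' (Icc 1 N)))
  rw [h1] at h3
  linarith

theorem abs_covarianceKernel_le_sum (h : IsLogWeight N A B w) {p r : ℕ} (hp : p.Prime)
    (hr : r.Prime) (hpr : p < r) :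
    |covarianceKernel w N p r| ≤
      ∑ n ∈ Icc 1 N with ((n : ℕ) : ℝ) ≤ N ∧ (N : ℝ) < p * n, w n +
      ∑ n ∈ Icc 1 N with p ∣ n ∧ ((n : ℕ) : ℝ) ≤ N ∧ (N : ℝ) < r * n, w n +
      ∑ n ∈ Icc 1 N with p ∣ n ∧ r ∣ n, w n +
      ∑ n ∈ Icc 1 N with ((n : ℕ) : ℝ) ≤ N / r ∧ (N / r : ℝ) < p * n, w n := by
  simp only [sum_filter, ← sum_add_distrib]
  refine (abs_sum_le_sum_abs _ _).trans (sum_le_sum fun n hn => ?_)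
  have hw := h.nonneg n
  have hr0 : (0 : ℝ) < r := by exact_mod_cast hr.pos
  have e1 : (((n : ℕ) : ℝ) ≤ N ∧ (N : ℝ) < p * n) ↔ ¬ p * n ≤ N := by
    have := (mem_Icc.1 hn).2
    norm_cast
    omega
  have e2 : (((n : ℕ) : ℝ) ≤ N ∧ (N : ℝ) < r * n) ↔ ¬ r * n ≤ N := by
    have := (mem_Icc.1 hn).2
    norm_cast
    omega
  have e3 : (((n : ℕ) : ℝ) ≤ N / r ∧ (N / r : ℝ) < p * n) ↔ r * n ≤ N ∧ ¬ p * (r * n) ≤ N := by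
    rw [le_div_iff₀ hr0, div_lt_iff₀ hr0, not_le]
    norm_cast
    rw [mul_comm n r, mul_assoc, mul_comm n r]
  simp only [e1, e2, e3, hp.coprime_iff_not_dvd, hr.coprime_iff_not_dvd]
  have i1 : p * n ≤ r * n := Nat.mul_le_mul_right n hpr.le
  have i2 : r * n ≤ p * (r * n) := Nat.le_mul_of_pos_left _ hp.pos
  rw [abs_mul, abs_of_nonneg hw]
  -- The cutoffs are nested. When all three hold, the bracket factors as the product of the
  -- indicators of `p ∣ n` and `r ∣ n`.
  by_cases c1 : p * n ≤ N <;> by_cases c2 : r * n ≤ N <;> by_cases c3 : p * (r * n) ≤ N <;>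
    first
    | (exfalso; omega)
    | (by_cases d1 : p ∣ n <;> by_cases d2 : r ∣ n <;> simp [c1, c2, c3, d1, d2, hw])

/-! ### Weighted square sums of the kernel factors. -/

theorem sum_prime_mul_log_mul_le (h : IsLogWeight N A B w) {φ : ℕ → ℝ} (hφ : ∀ p, 0 ≤ φ p) :
    ∑ p ∈ Icc 1 N with p.Prime, w p * Real.log p * φ p ≤
      A * ∑ p ∈ Icc 1 N with p.Prime, Real.log p / p * φ p := by
  rw [mul_sum]
  refine sum_le_sum fun p hp => ?_
  obtain ⟨hp1, hp2⟩ := mem_filter.1 hp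
  have h1 := h.prime_le p hp2 (mem_Icc.1 hp1).2
  have h2 := mul_nonneg (Real.log_natCast_nonneg p) (hφ p)
  calc w p * Real.log p * φ p = w p * (Real.log p * φ p) := by ring
    _ ≤ A / p * (Real.log p * φ p) := mul_le_mul_of_nonneg_right h1 h2
    _ = A * (Real.log p / p * φ p) := by ring

theorem sum_prime_mul_log_div_le (h : IsLogWeight N A B w) (hN : 1 ≤ N) :
    ∑ p ∈ Icc 1 N with p.Prime, w p * √(Real.log p / (1 + Real.log N)) ^ 2 ≤
      4 * (Real.exp 1 * Real.log 4 * A) := by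
  have hN0 : (1 : ℝ) ≤ N := by exact_mod_cast hN
  have hL : 0 < 1 + Real.log N := by linarith [Real.log_natCast_nonneg N]
  have h1 := h.sum_prime_mul_log_mul_le (φ := fun _ => 1) (fun _ => zero_le_one)
  -- With `d = 2 * N` the strict lower condition holds for every prime, so the whole range is
  -- covered.
  have h2 := sum_log_div_prime_le_of_short (s := (Icc 1 N).filter Nat.Prime) (y := N) (d := 2 * N)
    (fun p hp => (mem_filter.1 hp).2) (by linarith) (fun p hp => by
      have h3 := mem_Icc.1 (mem_filter.1 hp).1
      have h4 : (1 : ℝ) ≤ p := by exact_mod_cast h3.1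
      exact ⟨by exact_mod_cast h3.2, by nlinarith⟩)
  rw [Real.log_mul (by norm_num) (by linarith)] at h2
  simp only [mul_one] at h1
  have h5 : ∑ p ∈ Icc 1 N with p.Prime, w p * √(Real.log p / (1 + Real.log N)) ^ 2 =
      (∑ p ∈ Icc 1 N with p.Prime, w p * Real.log p) / (1 + Real.log N) := by
    rw [sum_div]
    refine sum_congr rfl fun p _ => ?_
    rw [Real.sq_sqrt (div_nonneg (Real.log_natCast_nonneg p) hL.le), mul_div_assoc]
  rw [h5, div_le_iff₀ hL]
  refine h1.trans ((mul_le_mul_of_nonneg_left h2 h.nonneg_left).trans ?_)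
  have hl : 0 < Real.log 4 := Real.log_pos (by norm_num)
  have h6 : 0 ≤ Real.exp 1 * Real.log 4 * A := mul_nonneg (by positivity) h.nonneg_left
  have h7 : 1 + (Real.log 2 + Real.log N) ≤ 4 * (1 + Real.log N) := by
    linarith [Real.log_two_lt_d9, Real.log_natCast_nonneg N]
  linarith [mul_le_mul_of_nonneg_left h7 h6]

theorem sum_prime_mul_sqrt_log_div_le (h : IsLogWeight N A B w) :
    ∑ p ∈ Icc 1 N with p.Prime, w p * √√(Real.log p / (1 + Real.log N)) ^ 2 ≤
      4 * (Real.exp 1 * Real.log 4 * A) := by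
  have hL : 0 < 1 + Real.log N := by linarith [Real.log_natCast_nonneg N]
  have hs := Real.sqrt_pos.2 hL
  have h1 := h.sum_prime_mul_log_mul_le (φ := fun p => 1 / √(Real.log p)) (fun _ => by positivity)
  have h2 := sum_log_div_prime_mul_inv_sqrt_log_le (N := N)
  have h5 : ∑ p ∈ Icc 1 N with p.Prime, w p * √√(Real.log p / (1 + Real.log N)) ^ 2 =
      (∑ p ∈ Icc 1 N with p.Prime, w p * Real.log p * (1 / √(Real.log p))) /
        √(1 + Real.log N) := by
    rw [sum_div]
    refine sum_congr rfl fun p hp => ?_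
    rw [Real.sq_sqrt (Real.sqrt_nonneg _), Real.sqrt_div' _ hL.le]
    nth_rewrite 2 [← Real.mul_self_sqrt (Real.log_natCast_nonneg p)]
    have h3 : 0 < √(Real.log p) :=
      Real.sqrt_pos.2 (by linarith [log_two_le_log_prime (mem_filter.1 hp).2])
    field_simp
  rw [h5, div_le_iff₀ hs]
  refine h1.trans ((mul_le_mul_of_nonneg_left h2 h.nonneg_left).trans (le_of_eq (by ring)))

theorem sum_prime_mul_log_mul_sqrt_div_le (h : IsLogWeight N A B w) (hN : 1 ≤ N) :
    ∑ p ∈ Icc 1 N with p.Prime, w p * √(Real.log p / (1 + Real.log N) *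
      √((1 + Real.log N) / (1 + Real.log (N / p)))) ^ 2 ≤
      4 * (Real.exp 1 * Real.log 4 * A) := by
  have hL : 0 < 1 + Real.log N := by linarith [Real.log_natCast_nonneg N]
  have hs := Real.sqrt_pos.2 hL
  have h1 := h.sum_prime_mul_log_mul_le (φ := fun p => 1 / √(1 + Real.log (N / p)))
    (fun _ => by positivity)
  have h2 := sum_log_div_prime_mul_inv_sqrt_log_div_le hN
  have h5 : ∑ p ∈ Icc 1 N with p.Prime, w p * √(Real.log p / (1 + Real.log N) *
      √((1 + Real.log N) / (1 + Real.log (N / p)))) ^ 2 =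
      (∑ p ∈ Icc 1 N with p.Prime, w p * Real.log p * (1 / √(1 + Real.log (N / p)))) /
        √(1 + Real.log N) := by
    rw [sum_div]
    refine sum_congr rfl fun p hp => ?_
    rw [Real.sq_sqrt (mul_nonneg (div_nonneg (Real.log_natCast_nonneg p) hL.le)
      (Real.sqrt_nonneg _)), Real.sqrt_div hL.le]
    nth_rewrite 1 [← Real.mul_self_sqrt hL.le]
    field_simp
  rw [h5, div_le_iff₀ hs]
  refine h1.trans ((mul_le_mul_of_nonneg_left h2 h.nonneg_left).trans ?_)
  have hl : 0 < Real.log 4 := Real.log_pos (by norm_num)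
  have h6 : 0 ≤ Real.exp 1 * Real.log 4 * A * √(1 + Real.log N) :=
    mul_nonneg (mul_nonneg (by positivity) h.nonneg_left) hs.le
  linarith

/-- The local sum is at most `A * log p / p` plus a part `b p` from proper powers. The first is
square-summable against `A / p`; the second satisfies `b p ≤ B` and has total at most `B`. -/
theorem sum_prime_mul_localLogSum_sq_le (h : IsLogWeight N A B w) :
    ∑ p ∈ Icc 1 N with p.Prime, w p * localLogSum w N p ^ 2 ≤ 16 * A ^ 3 + 2 * A * B ^ 2 := by
  have hA := h.nonneg_left
  have hB := h.nonneg_right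
  set b : ℕ → ℝ := fun p =>
    ∑ q ∈ {q ∈ Icc 1 N | IsPrimePow q ∧ ¬ q.Prime} with p ∣ q, w q * Real.log q with hb
  have hwl : ∀ q, 0 ≤ w q * Real.log q :=
    fun q => mul_nonneg (h.nonneg q) (Real.log_natCast_nonneg q)
  have hb0 : ∀ p, 0 ≤ b p := fun p => sum_nonneg fun q _ => hwl q
  have hbB : ∀ p, b p ≤ B := fun p =>
    (sum_le_sum_of_subset_of_nonneg (filter_subset _ _) fun q _ _ => hwl q).trans h.sum_le
  -- A prime power has only one prime divisor, so the sums `b p` do not overlap.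
  have hbs : ∑ p ∈ Icc 1 N with p.Prime, b p ≤ B := by
    refine le_trans ?_ h.sum_le
    simp only [hb]
    simp_rw [sum_filter (p := fun q => _ ∣ q)]
    rw [sum_comm]
    refine sum_le_sum fun q hq => ?_
    obtain ⟨p₀, hp₀, hu⟩ := isPrimePow_iff_unique_prime_dvd.1 (mem_filter.1 hq).2.1
    rw [← sum_filter, sum_const, nsmul_eq_mul]
    refine mul_le_of_le_one_left (hwl q) ?_
    have : #{p ∈ {p ∈ Icc 1 N | p.Prime} | p ∣ q} ≤ 1 := by
      refine card_le_one.2 fun a ha b hb => ?_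
      simp only [mem_filter] at ha hb
      rw [hu a ⟨ha.1.2, ha.2⟩, hu b ⟨hb.1.2, hb.2⟩]
    exact_mod_cast this
  have he : ∀ p ∈ {p ∈ Icc 1 N | p.Prime}, localLogSum w N p ≤ A * (Real.log p / p) + b p := by
    intro p hp
    obtain ⟨hpN, hpp⟩ := mem_filter.1 hp
    have h1 : localLogSum w N p ≤ ∑ q ∈ insert p
        {q ∈ {q ∈ Icc 1 N | IsPrimePow q ∧ ¬ q.Prime} | p ∣ q}, w q * Real.log q := by
      refine sum_le_sum_of_subset_of_nonneg (fun q hq => ?_) fun q _ _ => hwl q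
      simp only [mem_filter, mem_insert] at hq ⊢
      by_cases hqp : q.Prime
      · exact Or.inl ((Nat.prime_dvd_prime_iff_eq hpp hqp).1 hq.2.2).symm
      · exact Or.inr ⟨⟨hq.1, hq.2.1, hqp⟩, hq.2.2⟩
    rw [sum_insert (by simp [hpp])] at h1
    have h2 := mul_le_mul_of_nonneg_right (h.prime_le p hpp (mem_Icc.1 hpN).2)
      (Real.log_natCast_nonneg p)
    have h3 : A / p * Real.log p = A * (Real.log p / p) := by ring
    linarith
  have h1 : ∀ p ∈ {p ∈ Icc 1 N | p.Prime}, w p * localLogSum w N p ^ 2 ≤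
      2 * A ^ 3 * (Real.log p ^ 2 / (p : ℝ) ^ 3) + 2 * A * B * b p := by
    intro p hp
    obtain ⟨hpN, hpp⟩ := mem_filter.1 hp
    have hp1 : (1 : ℝ) ≤ p := by exact_mod_cast hpp.one_le
    have hp0 : (0 : ℝ) < p := by linarith
    have hw := h.prime_le p hpp (mem_Icc.1 hpN).2
    have hwA : A / p ≤ A := div_le_self hA hp1
    have h2 := pow_le_pow_left₀ (h.localLogSum_nonneg p) (he p hp) 2
    have h3 : localLogSum w N p ^ 2 ≤ 2 * (A * (Real.log p / p)) ^ 2 + 2 * b p ^ 2 :=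
      
      h2.trans (by nlinarith [sq_nonneg (A * (Real.log p / p) - b p)])
    have h4 : b p ^ 2 ≤ B * b p := by nlinarith [hb0 p, hbB p]
    calc w p * localLogSum w N p ^ 2 ≤ A / p * (2 * (A * (Real.log p / p)) ^ 2 + 2 * b p ^ 2) :=
          mul_le_mul hw h3 (sq_nonneg _) (by positivity)
      _ = 2 * A ^ 3 * (Real.log p ^ 2 / (p : ℝ) ^ 3) + A / p * (2 * b p ^ 2) := by
          field_simp
      _ ≤ 2 * A ^ 3 * (Real.log p ^ 2 / (p : ℝ) ^ 3) + A * (2 * (B * b p)) := by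
          gcongr
      _ = _ := by ring
  refine (sum_le_sum h1).trans ?_
  rw [sum_add_distrib, ← mul_sum, ← mul_sum]
  have h5 : ∑ p ∈ Icc 1 N with p.Prime, Real.log p ^ 2 / (p : ℝ) ^ 3 ≤ 8 :=
    (sum_le_sum_of_subset_of_nonneg (filter_subset _ _) fun n _ _ => by positivity).trans
      (sum_log_sq_div_cube_le N)
  have h6 := mul_le_mul_of_nonneg_left h5 (show 0 ≤ 2 * A ^ 3 by positivity)
  have h7 := mul_le_mul_of_nonneg_left hbs (show 0 ≤ 2 * A * B by positivity)
  nlinarith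

theorem abs_covarianceKernel_le_of_lt (h : IsLogWeight N A B w) {p r : ℕ} (hp : p.Prime)
    (hr : r.Prime) (hpr : p < r) (hrN : r ≤ N) :
    |covarianceKernel w N p r| ≤ 9 * (1 + Real.exp 1 * Real.log 4 * A + B) *
      (∑ n ∈ Icc 1 N, w n) *
      (√(Real.log p / (1 + Real.log N)) * √(Real.log r / (1 + Real.log N)) +
        localLogSum w N p * localLogSum w N r +
        localLogSum w N p * √(Real.log r / (1 + Real.log N)) +
        √√(Real.log p / (1 + Real.log N)) * √(Real.log r / (1 + Real.log N) *
          √((1 + Real.log N) / (1 + Real.log (N / r))))) := by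
  have hp1 : (1 : ℝ) ≤ p := by exact_mod_cast hp.one_le
  have hr1 : (1 : ℝ) ≤ r := by exact_mod_cast hr.one_le
  have hrN' : (r : ℝ) ≤ N := by exact_mod_cast hrN
  have hN1 : (1 : ℝ) ≤ N := hr1.trans hrN'
  have hNr : 1 ≤ (N : ℝ) / r := (one_le_div (by linarith)).2 hrN'
  have h1 := h.sum_short_le hp1 hN1
  have h2 := h.sum_dvd_short_le hr1 hN1 hp
  have h3 := h.sum_dvd_dvd_le hp hr hpr.ne
  have h4 := h.sum_short_le hp1 hNr
  have h4' := h.sum_filter_le_sum (fun n => ((n : ℕ) : ℝ) ≤ N / r ∧ (N / r : ℝ) < p * n)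
  have h5 := h.abs_covarianceKernel_le_sum hp hr hpr
  have hT1 := h.sum_nonneg' {n ∈ Icc 1 N | ((n : ℕ) : ℝ) ≤ N ∧ (N : ℝ) < p * n}
  have hT4 := h.sum_nonneg' {n ∈ Icc 1 N | ((n : ℕ) : ℝ) ≤ N / r ∧ (N / r : ℝ) < p * n}
  set T₁ := ∑ n ∈ Icc 1 N with ((n : ℕ) : ℝ) ≤ N ∧ (N : ℝ) < p * n, w n
  set T₃ := ∑ n ∈ Icc 1 N with p ∣ n ∧ ((n : ℕ) : ℝ) ≤ N ∧ (N : ℝ) < r * n, w n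
  set T₂ := ∑ n ∈ Icc 1 N with p ∣ n ∧ r ∣ n, w n
  set T₄ := ∑ n ∈ Icc 1 N with ((n : ℕ) : ℝ) ≤ N / r ∧ (N / r : ℝ) < p * n, w n
  have hS := h.sum_nonneg' (Icc 1 N)
  set S := ∑ n ∈ Icc 1 N, w n
  have hep := h.localLogSum_nonneg p
  have her := h.localLogSum_nonneg r
  set e := localLogSum w N p
  set e' := localLogSum w N r
  have hl4 : 0 < Real.log 4 := Real.log_pos (by norm_num)
  have hA := h.nonneg_left
  have hB := h.nonneg_right
  have hκ : 1 ≤ 1 + Real.exp 1 * Real.log 4 * A + B := by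
    have : 0 ≤ Real.exp 1 * Real.log 4 * A := by positivity
    linarith
  set κ := 1 + Real.exp 1 * Real.log 4 * A + B
  have hlp := log_two_le_log_prime hp
  have hlr := log_two_le_log_prime hr
  have hlpr : Real.log p ≤ Real.log r := Real.log_le_log (by linarith) (by exact_mod_cast hpr.le)
  have hlrN : Real.log r ≤ Real.log N := Real.log_le_log (by linarith) hrN'
  have hlNr : Real.log (N / r) = Real.log N - Real.log r :=
    Real.log_div (by linarith) (by linarith)
  have hlNr0 : 0 ≤ Real.log (N / r) := Real.log_nonneg hNr
  set a := Real.log p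
  set b := Real.log r
  set L := 1 + Real.log N with hL
  have hL0 : 0 < L := by linarith
  have hκS : 0 ≤ κ * S := by positivity
  -- Since `a ≥ 1 / 2`, `1 + a ≤ 3 * a`.
  have ha3 : κ * (1 + a) * S ≤ 3 * κ * a * S := by nlinarith
  have hb3 : κ * (1 + b) * (e * S) ≤ 3 * κ * b * (e * S) := by
    nlinarith [mul_nonneg hκS hep]
  have k1 : T₁ ≤ 3 * κ * S * (√(a / L) * √(b / L)) := by
    have : a / L ≤ √(a / L) * √(b / L) := by
      calc a / L = √(a / L) * √(a / L) := (Real.mul_self_sqrt (by positivity)).symm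
        _ ≤ _ := by gcongr
    refine le_trans ?_ (mul_le_mul_of_nonneg_left this (by positivity))
    rw [mul_div_assoc', le_div_iff₀ hL0]
    linarith
  have k3 : T₃ ≤ 9 * κ * S * (e * √(b / L)) := by
    have h0 : b / L ≤ √(b / L) := by
      refine Real.le_sqrt_of_sq_le (pow_le_of_le_one (by positivity) ?_ (by norm_num))
      rw [div_le_one hL0]; linarith
    have h1' : T₃ ≤ 9 * κ * S * (e * (b / L)) := by
      rw [mul_div_assoc', mul_div_assoc', le_div_iff₀ hL0]
      linarith
    exact h1'.trans (by gcongr)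
  have k2 : T₂ ≤ 4 * κ * S * (e * e') := by
    refine h3.trans ?_
    have : 0 ≤ e * e' * S := by positivity
    nlinarith
  have k4 := le_sqrt_mul_sqrt_add_of_mul_le (L := L) (b := b) (l := 1 + Real.log (N / r))
    (c := 3 * κ) (a := a) hT4 h4' (by linarith) (h4.trans ha3) (by linarith) hlpr
    (by linarith) (by rw [hlNr, hL]; ring)
  have q1 : 0 ≤ κ * S * (e * e') := by positivity
  have q2 : 0 ≤ κ * S * (√√(a / L) * √(b / L * √(L / (1 + Real.log (N / r))))) := by positivity
  linarith

end IsLogWeight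

/-! ### Bilinear estimates and the contribution of the primes. -/

theorem norm_sum_mul_ofReal_sq {ι : Type*} (s : Finset ι) (z : ι → ℂ) (x : ι → ℝ) :
    ‖∑ i ∈ s, z i * (x i : ℂ)‖ ^ 2 =
      ∑ i ∈ s, ∑ j ∈ s, (z i * (starRingEnd ℂ) (z j)).re * (x i * x j) := by
  rw [Complex.sq_norm, Complex.normSq_apply, Complex.re_sum, Complex.im_sum, sum_mul_sum,
    sum_mul_sum, ← sum_add_distrib]
  refine sum_congr rfl fun i _ => ?_
  rw [← sum_add_distrib]
  refine sum_congr rfl fun j _ => ?_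
  simp only [Complex.mul_re, Complex.mul_im, Complex.ofReal_re, Complex.ofReal_im, Complex.conj_re,
    Complex.conj_im]
  ring

theorem sum_mul_mul_sum_le {ι : Type*} (s : Finset ι) {a t g k : ι → ℝ} {M : ℝ}
    (ha : ∀ i ∈ s, 0 ≤ a i) (hg : ∑ i ∈ s, a i * g i ^ 2 ≤ M) (hk : ∑ i ∈ s, a i * k i ^ 2 ≤ M) :
    (∑ i ∈ s, a i * t i * g i) * (∑ i ∈ s, a i * t i * k i) ≤ M * ∑ i ∈ s, a i * t i ^ 2 := by
  have hQ : 0 ≤ ∑ i ∈ s, a i * t i ^ 2 := sum_nonneg fun i hi => mul_nonneg (ha i hi) (sq_nonneg _)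
  have key : ∀ f : ι → ℝ, ∑ i ∈ s, a i * f i ^ 2 ≤ M →
      (∑ i ∈ s, a i * t i * f i) ^ 2 ≤ M * ∑ i ∈ s, a i * t i ^ 2 := by
    intro f hf
    refine (sum_sq_le_sum_mul_sum_of_sq_le_mul s (f := fun i => a i * f i ^ 2)
      (g := fun i => a i * t i ^ 2) (fun i hi => mul_nonneg (ha i hi) (sq_nonneg _))
      (fun i hi => mul_nonneg (ha i hi) (sq_nonneg _)) fun i _ => le_of_eq (by ring)).trans ?_
    exact mul_le_mul_of_nonneg_right hf hQ
  nlinarith [key g hg, key k hk, sq_nonneg (∑ i ∈ s, a i * t i * g i - ∑ i ∈ s, a i * t i * k i)]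

namespace IsLogWeight

variable {N : ℕ} {A B : ℝ} {w : ℕ → ℝ}

/-- The Turán–Kubilius inequality for the contribution of the primes exactly dividing `n`. -/
theorem sum_prime_part_le (h : IsLogWeight N A B w) (hN : 1 ≤ N) {M : ℝ}
    (hM1 : 4 * (Real.exp 1 * Real.log 4 * A) ≤ M) (hM2 : 16 * A ^ 3 + 2 * A * B ^ 2 ≤ M)
    (θ : ℕ → ℂ) :
    ∑ n ∈ Icc 1 N, w n * ‖∑ p ∈ Icc 1 N with p.Prime, θ p * (centredIndicator w p n : ℂ)‖ ^ 2 ≤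
      (1 + A + 54 * (1 + Real.exp 1 * Real.log 4 * A + B) * M) * ((∑ n ∈ Icc 1 N, w n) *
        ∑ p ∈ Icc 1 N with p.Prime, w p * ‖θ p‖ ^ 2) := by
  set s := (Icc 1 N).filter Nat.Prime with hs
  have hS := h.sum_nonneg' (Icc 1 N)
  set S := ∑ n ∈ Icc 1 N, w n with hS'
  set κ := 1 + Real.exp 1 * Real.log 4 * A + B with hκ'
  set g₁ : ℕ → ℝ := fun p => √(Real.log p / (1 + Real.log N)) with hg₁
  set g₂ : ℕ → ℝ := localLogSum w N with hg₂
  set g₃ : ℕ → ℝ := fun p => √√(Real.log p / (1 + Real.log N)) with hg₃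
  set g₄ : ℕ → ℝ := fun p => √(Real.log p / (1 + Real.log N) *
    √((1 + Real.log N) / (1 + Real.log (N / p)))) with hg₄
  have hA := h.nonneg_left
  have hB := h.nonneg_right
  have hl4 : 0 < Real.log 4 := Real.log_pos (by norm_num)
  have hκ : 0 ≤ κ := by positivity
  have p1 : ∀ p, 0 ≤ g₁ p := fun p => Real.sqrt_nonneg _
  have p2 : ∀ p, 0 ≤ g₂ p := fun p => h.localLogSum_nonneg p
  have p3 : ∀ p, 0 ≤ g₃ p := fun p => Real.sqrt_nonneg _
  have p4 : ∀ p, 0 ≤ g₄ p := fun p => Real.sqrt_nonneg _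
  have b1 : ∑ p ∈ s, w p * g₁ p ^ 2 ≤ M := (h.sum_prime_mul_log_div_le hN).trans hM1
  have b2 : ∑ p ∈ s, w p * g₂ p ^ 2 ≤ M := h.sum_prime_mul_localLogSum_sq_le.trans hM2
  have b3 : ∑ p ∈ s, w p * g₃ p ^ 2 ≤ M := h.sum_prime_mul_sqrt_log_div_le.trans hM1
  have b4 : ∑ p ∈ s, w p * g₄ p ^ 2 ≤ M := (h.sum_prime_mul_log_mul_sqrt_div_le hN).trans hM1
  -- The kernel bound for `p < r`, symmetrised to serve both orders. Its six products and the
  -- constant 9 produce the 54.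
  set R : ℕ → ℕ → ℝ := fun p r => g₁ p * g₁ r + g₂ p * g₂ r + g₂ p * g₁ r + g₁ p * g₂ r +
    g₃ p * g₄ r + g₄ p * g₃ r with hR
  have hR0 : ∀ p r, 0 ≤ R p r := fun p r => by
    have := p1 p; have := p1 r; have := p2 p; have := p2 r
    have := p3 p; have := p3 r; have := p4 p; have := p4 r
    positivity
  have hlt : ∀ p ∈ s, ∀ r ∈ s, p < r → |covarianceKernel w N p r| ≤ 9 * κ * S * R p r := by
    intro p hp r hr hpr
    refine (h.abs_covarianceKernel_le_of_lt (mem_filter.1 hp).2 (mem_filter.1 hr).2 hpr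
      (mem_Icc.1 (mem_filter.1 hr).1).2).trans (mul_le_mul_of_nonneg_left ?_ (by positivity))
    have q1 := mul_nonneg (p1 p) (p2 r)
    have q2 := mul_nonneg (p4 p) (p3 r)
    simp only [hR]
    linarith
  have hne : ∀ p ∈ s, ∀ r ∈ s, p ≠ r → |covarianceKernel w N p r| ≤ 9 * κ * S * R p r := by
    intro p hp r hr hpr
    rcases lt_or_gt_of_ne hpr with h1 | h1
    · exact hlt p hp r hr h1
    · rw [covarianceKernel_comm]
      refine (hlt r hr p hp h1).trans (le_of_eq ?_)
      simp only [hR]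
      ring
  have hexp : ∑ n ∈ Icc 1 N, w n * ‖∑ p ∈ s, θ p * (centredIndicator w p n : ℂ)‖ ^ 2 =
      ∑ p ∈ s, ∑ r ∈ s, (θ p * (starRingEnd ℂ) (θ r)).re *
        ∑ n ∈ Icc 1 N, w n * (centredIndicator w p n * centredIndicator w r n) := by
    simp only [norm_sum_mul_ofReal_sq, mul_sum]
    rw [sum_comm]
    refine sum_congr rfl fun p _ => ?_
    rw [sum_comm]
    exact sum_congr rfl fun r _ => sum_congr rfl fun n _ => by ring
  have hterm : ∀ p ∈ s, ∀ r ∈ s, (θ p * (starRingEnd ℂ) (θ r)).re *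
      ∑ n ∈ Icc 1 N, w n * (centredIndicator w p n * centredIndicator w r n) ≤
      (if p = r then (1 + A) * S * (w p * ‖θ p‖ ^ 2) else 0) +
        9 * κ * S * (w p * ‖θ p‖ * (w r * ‖θ r‖) * R p r) := by
    intro p hp r hr
    have hc : |(θ p * (starRingEnd ℂ) (θ r)).re| ≤ ‖θ p‖ * ‖θ r‖ := by
      refine (Complex.abs_re_le_norm _).trans (le_of_eq ?_)
      rw [norm_mul, RCLike.norm_conj]
    have hw : 0 ≤ w p * ‖θ p‖ * (w r * ‖θ r‖) := by
      have := h.nonneg p; have := h.nonneg r; positivity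
    have hpp := (mem_filter.1 hp).2
    have hrp := (mem_filter.1 hr).2
    split_ifs with hpr
    · subst hpr
      have h1 := h.sum_centredIndicator_sq_le hpp (mem_Icc.1 (mem_filter.1 hp).1).2
      have h2 : 0 ≤ ∑ n ∈ Icc 1 N, w n * (centredIndicator w p n * centredIndicator w p n) :=
        sum_nonneg fun n _ => mul_nonneg (h.nonneg n) (mul_self_nonneg _)
      have h3 := mul_le_mul ((le_abs_self _).trans hc) h1 h2 (by positivity)
      have h4 : 0 ≤ 9 * κ * S * (w p * ‖θ p‖ * (w p * ‖θ p‖) * R p p) :=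
        mul_nonneg (by positivity) (mul_nonneg hw (hR0 p p))
      linarith
    · rw [h.sum_centredIndicator_mul hpp.pos hrp.pos ((Nat.coprime_primes hpp hrp).2 hpr), zero_add]
      refine (le_abs_self _).trans ?_
      rw [abs_mul, abs_mul, abs_of_nonneg (mul_nonneg (h.nonneg p) (h.nonneg r))]
      calc _ ≤ ‖θ p‖ * ‖θ r‖ * (w p * w r * (9 * κ * S * R p r)) := by
            have := h.nonneg p; have := h.nonneg r
            have := hne p hp r hr hpr
            gcongr
        _ = _ := by ring
  have hfac : ∀ f k : ℕ → ℝ, ∑ p ∈ s, ∑ r ∈ s, w p * ‖θ p‖ * (w r * ‖θ r‖) * (f p * k r) =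
      (∑ p ∈ s, w p * ‖θ p‖ * f p) * ∑ r ∈ s, w r * ‖θ r‖ * k r := by
    intro f k
    rw [sum_mul_sum]
    exact sum_congr rfl fun p _ => sum_congr rfl fun r _ => by ring
  have hbil : ∀ f k : ℕ → ℝ, ∑ p ∈ s, w p * f p ^ 2 ≤ M → ∑ p ∈ s, w p * k p ^ 2 ≤ M →
      ∑ p ∈ s, ∑ r ∈ s, w p * ‖θ p‖ * (w r * ‖θ r‖) * (f p * k r) ≤
        M * ∑ p ∈ s, w p * ‖θ p‖ ^ 2 := fun f k hf hk => by
    rw [hfac]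
    exact sum_mul_mul_sum_le s (fun p _ => h.nonneg p) hf hk
  have hsum : ∑ p ∈ s, ∑ r ∈ s, w p * ‖θ p‖ * (w r * ‖θ r‖) * R p r ≤
      6 * (M * ∑ p ∈ s, w p * ‖θ p‖ ^ 2) := by
    simp only [hR, mul_add, sum_add_distrib]
    linarith [hbil g₁ g₁ b1 b1, hbil g₂ g₂ b2 b2, hbil g₂ g₁ b2 b1, hbil g₁ g₂ b1 b2,
      hbil g₃ g₄ b3 b4, hbil g₄ g₃ b4 b3]
  rw [hexp]
  refine (sum_le_sum fun p hp => sum_le_sum fun r hr => hterm p hp r hr).trans ?_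
  simp only [sum_add_distrib, sum_ite_eq, ← mul_sum]
  have hdiag : ∑ p ∈ s, (if p ∈ s then (1 + A) * S * (w p * ‖θ p‖ ^ 2) else 0) =
      (1 + A) * S * ∑ p ∈ s, w p * ‖θ p‖ ^ 2 := by
    rw [sum_congr rfl fun p hp => if_pos hp, ← mul_sum]
  rw [hdiag]
  have := mul_le_mul_of_nonneg_left hsum (show 0 ≤ 9 * κ * S by positivity)
  linarith

/-! ### The contribution of the proper prime powers. -/

theorem sum_proper_norm_sq_le (h : IsLogWeight N A B w) (θ : ℕ → ℂ) :
    (∑ q ∈ Icc 1 N with IsPrimePow q ∧ ¬ q.Prime, w q * ‖θ q‖) ^ 2 ≤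
      2 * B * ∑ q ∈ Icc 1 N with IsPrimePow q ∧ ¬ q.Prime, w q * ‖θ q‖ ^ 2 := by
  have h1 : ∑ q ∈ Icc 1 N with IsPrimePow q ∧ ¬ q.Prime, w q ≤ 2 * B := by
    refine le_trans ?_ (mul_le_mul_of_nonneg_left h.sum_le zero_le_two)
    rw [mul_sum]
    refine sum_le_sum fun q hq => ?_
    have hq2 : (2 : ℝ) ≤ q := by exact_mod_cast (mem_filter.1 hq).2.1.two_le
    have h1 := Real.log_le_log (by norm_num) hq2
    nlinarith [h.nonneg q, Real.log_two_gt_d9]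
  refine (sum_sq_le_sum_mul_sum_of_sq_le_mul _ (f := w) (g := fun q => w q * ‖θ q‖ ^ 2)
    (fun q _ => h.nonneg q) (fun q _ => mul_nonneg (h.nonneg q) (sq_nonneg _))
    fun q _ => le_of_eq (by ring)).trans ?_
  exact mul_le_mul_of_nonneg_right h1
    (sum_nonneg fun q _ => mul_nonneg (h.nonneg q) (sq_nonneg _))

theorem sum_unitaryDvd_le (h : IsLogWeight N A B w) {q : ℕ} (hq : 0 < q) :
    ∑ n ∈ Icc 1 N, w n * (if UnitaryDvd q n then 1 else 0) ≤ w q * ∑ n ∈ Icc 1 N, w n := by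
  rw [h.sum_unitaryDvd hq]
  refine mul_le_mul_of_nonneg_left (sum_le_sum fun n _ => ?_) (h.nonneg q)
  have := h.nonneg n
  split_ifs <;> simp [this]

/-- If `q` and `r` are not coprime they are distinct powers of one prime, and cannot both exactly
divide `n`. -/
theorem sum_unitaryDvd_mul_le (h : IsLogWeight N A B w) {q r : ℕ} (hq : IsPrimePow q)
    (hr : IsPrimePow r) (hne : q ≠ r) :
    ∑ n ∈ Icc 1 N, w n * ((if UnitaryDvd q n then 1 else 0) * (if UnitaryDvd r n then 1 else 0)) ≤
      w q * w r * ∑ n ∈ Icc 1 N, w n := by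
  by_cases hqr : q.Coprime r
  · rw [h.sum_unitaryDvd_mul hq.pos hr.pos hqr]
    refine mul_le_mul_of_nonneg_left (sum_le_sum fun n _ => ?_)
      (mul_nonneg (h.nonneg q) (h.nonneg r))
    have := h.nonneg n
    split_ifs <;> simp [this]
  · refine le_trans (le_of_eq (sum_eq_zero fun n hn => ?_))
      (mul_nonneg (mul_nonneg (h.nonneg q) (h.nonneg r)) (h.sum_nonneg' _))
    have hn0 : n ≠ 0 := by have := (mem_Icc.1 hn).1; omega
    split_ifs with h1 h2
    · exact absurd (h1.coprime_of_ne hq hr hn0 h2 hne) hqr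
    all_goals simp

/-- The contribution of the proper prime powers, bounded in mean square. -/
theorem sum_proper_part_le (h : IsLogWeight N A B w) (θ : ℕ → ℂ) :
    ∑ n ∈ Icc 1 N, w n * ‖∑ q ∈ Icc 1 N with IsPrimePow q ∧ ¬ q.Prime,
        θ q * ((if UnitaryDvd q n then 1 else 0 : ℝ) : ℂ)‖ ^ 2 ≤
      (1 + 2 * B) * ((∑ n ∈ Icc 1 N, w n) *
        ∑ q ∈ Icc 1 N with IsPrimePow q ∧ ¬ q.Prime, w q * ‖θ q‖ ^ 2) := by
  have hcs := h.sum_proper_norm_sq_le θ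
  have hS := h.sum_nonneg' (Icc 1 N)
  set s := {q ∈ Icc 1 N | IsPrimePow q ∧ ¬ q.Prime} with hs
  set S := ∑ n ∈ Icc 1 N, w n with hS'
  have hexp : ∑ n ∈ Icc 1 N, w n *
      ‖∑ q ∈ s, θ q * ((if UnitaryDvd q n then 1 else 0 : ℝ) : ℂ)‖ ^ 2 =
      ∑ q ∈ s, ∑ r ∈ s, (θ q * (starRingEnd ℂ) (θ r)).re * ∑ n ∈ Icc 1 N,
        w n * ((if UnitaryDvd q n then 1 else 0) * (if UnitaryDvd r n then 1 else 0)) := by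
    simp only [norm_sum_mul_ofReal_sq s θ (fun q => (if UnitaryDvd q _ then 1 else 0 : ℝ)), mul_sum]
    rw [sum_comm]
    refine sum_congr rfl fun p _ => ?_
    rw [sum_comm]
    exact sum_congr rfl fun r _ => sum_congr rfl fun n _ => by ring
  have hterm : ∀ q ∈ s, ∀ r ∈ s, (θ q * (starRingEnd ℂ) (θ r)).re * ∑ n ∈ Icc 1 N,
        w n * ((if UnitaryDvd q n then 1 else 0) * (if UnitaryDvd r n then 1 else 0)) ≤
      (if q = r then S * (w q * ‖θ q‖ ^ 2) else 0) + S * (w q * ‖θ q‖ * (w r * ‖θ r‖)) := by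
    intro q hq r hr
    have hqp := (mem_filter.1 hq).2.1
    have hrp := (mem_filter.1 hr).2.1
    have hwq := h.nonneg q
    have hwr := h.nonneg r
    have hc : |(θ q * (starRingEnd ℂ) (θ r)).re| ≤ ‖θ q‖ * ‖θ r‖ := by
      refine (Complex.abs_re_le_norm _).trans (le_of_eq ?_)
      rw [norm_mul, RCLike.norm_conj]
    have hc' := (le_abs_self _).trans hc
    have h0 : 0 ≤ ∑ n ∈ Icc 1 N,
        w n * ((if UnitaryDvd q n then 1 else 0) * (if UnitaryDvd r n then 1 else 0)) :=
      sum_nonneg fun n _ => mul_nonneg (h.nonneg n) (by split_ifs <;> simp)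
    split_ifs with hqr
    · subst hqr
      have h1 : ∑ n ∈ Icc 1 N,
          w n * ((if UnitaryDvd q n then 1 else 0) * (if UnitaryDvd q n then 1 else 0)) ≤
            w q * S := by
        refine le_trans (le_of_eq (sum_congr rfl fun n _ => ?_)) (h.sum_unitaryDvd_le hqp.pos)
        split_ifs <;> simp
      have h2 := mul_le_mul hc' h1 h0 (by positivity)
      have h3 : 0 ≤ S * (w q * ‖θ q‖ * (w q * ‖θ q‖)) := by positivity
      linarith
    · have h2 := mul_le_mul hc' (h.sum_unitaryDvd_mul_le hqp hrp hqr) h0 (by positivity)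
      linarith
  rw [hexp]
  refine (sum_le_sum fun q hq => sum_le_sum fun r hr => hterm q hq r hr).trans ?_
  simp only [sum_add_distrib, sum_ite_eq, ← mul_sum]
  have hdiag : ∑ q ∈ s, (if q ∈ s then S * (w q * ‖θ q‖ ^ 2) else 0) =
      S * ∑ q ∈ s, w q * ‖θ q‖ ^ 2 := by
    rw [sum_congr rfl fun p hp => if_pos hp, ← mul_sum]
  rw [hdiag, ← sum_mul, ← sq]
  have := mul_le_mul_of_nonneg_left hcs hS
  linarith

/-! ### Combination of the two contributions. -/

/-- The Turán–Kubilius inequality for a weight and a function that is additive on coprime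
arguments. -/
theorem turanKubilius (h : IsLogWeight N A B w) (hN : 1 ≤ N) {M : ℝ}
    (hM1 : 4 * (Real.exp 1 * Real.log 4 * A) ≤ M) (hM2 : 16 * A ^ 3 + 2 * A * B ^ 2 ≤ M)
    {θ : ℕ → ℂ} (hθ : ∀ m n : ℕ, 0 < m → 0 < n → m.Coprime n → θ (m * n) = θ m + θ n) :
    ∑ n ∈ Icc 1 N, w n * ‖θ n - ∑ q ∈ Icc 1 N with IsPrimePow q, θ q * (w q : ℂ)‖ ^ 2 ≤
      3 * (2 + A + 4 * B + 54 * (1 + Real.exp 1 * Real.log 4 * A + B) * M) *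
        ((∑ n ∈ Icc 1 N, w n) * ∑ q ∈ Icc 1 N with IsPrimePow q, w q * ‖θ q‖ ^ 2) := by
  have hθ1 : θ 1 = 0 := by simpa using hθ 1 1 one_pos one_pos (Nat.coprime_one_left 1)
  have hsplit : ∀ {E : Type} [AddCommMonoid E] (f : ℕ → E),
      ∑ q ∈ Icc 1 N with IsPrimePow q, f q = ∑ p ∈ Icc 1 N with p.Prime, f p +
        ∑ q ∈ Icc 1 N with IsPrimePow q ∧ ¬ q.Prime, f q := by
    intro E _ f
    rw [← sum_filter_add_sum_filter_not _ Nat.Prime, filter_filter, filter_filter]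
    congr 2
    ext q
    simp only [mem_filter]
    exact and_congr_right fun _ => ⟨fun hq => hq.2, fun hq => ⟨hq.isPrimePow, hq⟩⟩
  have hP := h.sum_prime_part_le hN hM1 hM2 θ
  have hQ := h.sum_proper_part_le θ
  have hcs := h.sum_proper_norm_sq_le θ
  have hS := h.sum_nonneg' (Icc 1 N)
  set S := ∑ n ∈ Icc 1 N, w n with hS'
  set κ := 1 + Real.exp 1 * Real.log 4 * A + B with hκ'
  set t := {q ∈ Icc 1 N | IsPrimePow q ∧ ¬ q.Prime} with ht
  set s := {p ∈ Icc 1 N | p.Prime} with hs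
  set P : ℕ → ℂ := fun n => ∑ p ∈ s, θ p * (centredIndicator w p n : ℂ) with hPd
  set Q : ℕ → ℂ := fun n => ∑ q ∈ t, θ q * ((if UnitaryDvd q n then 1 else 0 : ℝ) : ℂ) with hQd
  set Z : ℂ := ∑ q ∈ t, θ q * (w q : ℂ) with hZ
  -- Only the primes are centred inside the sum; the centre `Z` of the proper prime powers is split
  -- off and bounded on its own.
  have hdec : ∀ n ∈ Icc 1 N,
      θ n - ∑ q ∈ Icc 1 N with IsPrimePow q, θ q * (w q : ℂ) = P n + Q n - Z := by
    intro n hn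
    have h1 : θ n = ∑ q ∈ Icc 1 N with IsPrimePow q,
        θ q * ((if UnitaryDvd q n then 1 else 0 : ℝ) : ℂ) := by
      rw [additive_eq_sum_unitaryDvd θ hθ hθ1 hn, ← filter_filter, sum_filter]
      refine sum_congr rfl fun q _ => ?_
      split_ifs <;> simp
    rw [h1, hsplit, hsplit, hPd, hQd, hZ]
    simp only [centredIndicator, Complex.ofReal_sub, mul_sub, sum_sub_distrib]
    ring
  have hnorm : ∀ n, ‖P n + Q n - Z‖ ^ 2 ≤ 3 * ‖P n‖ ^ 2 + 3 * ‖Q n‖ ^ 2 + 3 * ‖Z‖ ^ 2 := by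
    intro n
    have h1 : ‖P n + Q n - Z‖ ≤ ‖P n‖ + ‖Q n‖ + ‖Z‖ :=
      (norm_sub_le _ _).trans (add_le_add_left (norm_add_le _ _) _)
    have h2 := pow_le_pow_left₀ (norm_nonneg _) h1 2
    nlinarith [sq_nonneg (‖P n‖ - ‖Q n‖), sq_nonneg (‖P n‖ - ‖Z‖), sq_nonneg (‖Q n‖ - ‖Z‖)]
  have hZn : ‖Z‖ ^ 2 ≤ 2 * B * ∑ q ∈ t, w q * ‖θ q‖ ^ 2 := by
    refine (pow_le_pow_left₀ (norm_nonneg _) ((norm_sum_le _ _).trans (le_of_eq ?_)) 2).trans hcs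
    refine sum_congr rfl fun q _ => ?_
    rw [norm_mul, Complex.norm_real, Real.norm_of_nonneg (h.nonneg q), mul_comm]
  have h1 : ∑ n ∈ Icc 1 N,
      w n * ‖θ n - ∑ q ∈ Icc 1 N with IsPrimePow q, θ q * (w q : ℂ)‖ ^ 2 ≤
      3 * ∑ n ∈ Icc 1 N, w n * ‖P n‖ ^ 2 + 3 * ∑ n ∈ Icc 1 N, w n * ‖Q n‖ ^ 2 +
        3 * (S * ‖Z‖ ^ 2) := by
    rw [hS', sum_mul, mul_sum, mul_sum, mul_sum, ← sum_add_distrib, ← sum_add_distrib]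
    refine sum_le_sum fun n hn => ?_
    rw [hdec n hn]
    linarith [mul_le_mul_of_nonneg_left (hnorm n) (h.nonneg n)]
  rw [hsplit (fun q => w q * ‖θ q‖ ^ 2)]
  have hX : 0 ≤ S * ∑ p ∈ s, w p * ‖θ p‖ ^ 2 :=
    mul_nonneg hS (sum_nonneg fun q _ => mul_nonneg (h.nonneg q) (sq_nonneg _))
  have hY : 0 ≤ S * ∑ q ∈ t, w q * ‖θ q‖ ^ 2 :=
    mul_nonneg hS (sum_nonneg fun q _ => mul_nonneg (h.nonneg q) (sq_nonneg _))
  set X := ∑ p ∈ s, w p * ‖θ p‖ ^ 2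
  set Y := ∑ q ∈ t, w q * ‖θ q‖ ^ 2
  have hA := h.nonneg_left
  have hB := h.nonneg_right
  have hl4 : 0 < Real.log 4 := Real.log_pos (by norm_num)
  have hM : 0 ≤ M := le_trans (by positivity) hM1
  have hκ : 0 ≤ κ := by positivity
  have hκM : 0 ≤ κ * M := by positivity
  have hZS := mul_le_mul_of_nonneg_left hZn hS
  have e1 : (1 + A + 54 * κ * M) * (S * X) ≤ (2 + A + 4 * B + 54 * κ * M) * (S * X) :=
    mul_le_mul_of_nonneg_right (by linarith) hX
  have e2 : (1 + 4 * B) * (S * Y) ≤ (2 + A + 4 * B + 54 * κ * M) * (S * Y) :=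
    mul_le_mul_of_nonneg_right (by linarith) hY
  linarith

end IsLogWeight

theorem MemMultClass.isLogWeight {x A B : ℝ} {l : ArithmeticFunction ℝ} (hx : 0 ≤ x)
    (hA : 0 ≤ A) (h : MemMultClass x A B l) (hl : ∀ n, 0 ≤ l n) :
    IsLogWeight ⌊x⌋₊ A B (fun n => l n / n) where
  nonneg n := div_nonneg (hl n) (Nat.cast_nonneg n)
  mul m n hmn := by
    rw [h.isMultiplicative.map_mul_of_coprime hmn, Nat.cast_mul, mul_div_mul_comm]
  prime_le p hp hpx := div_le_div_of_nonneg_right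
    ((le_abs_self _).trans (h.norm_prime_le p hp ((Nat.le_floor_iff hx).1 hpx)))
    (Nat.cast_nonneg p)
  sum_le := by
    refine le_trans (le_of_eq ?_) h.sum_le
    rw [properPrimePowersUpTo, primePowersUpTo, filter_filter]
    refine sum_congr rfl fun q _ => ?_
    rw [Real.norm_of_nonneg (hl q)]
    ring
  nonneg_left := hA

end LogTuranKubilius

theorem mainTheorem11 (A B : ℝ) (hA : 0 < A) (hB : 0 < B) :
    ∃ C : ℝ, ∀ (x : ℝ) (l : ArithmeticFunction ℝ) (θ : ℕ → ℂ), 1 ≤ x →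
      MemMultClass x A B l → (∀ n : ℕ, 0 ≤ l n) → IsAdditiveArith θ →
      ∑ n ∈ Finset.Icc 1 ⌊x⌋₊, l n / (n : ℝ) * ‖θ n - firstMoment l θ x‖ ^ 2 ≤
        C * ((∑ n ∈ Finset.Icc 1 ⌊x⌋₊, l n / (n : ℝ)) * secondMoment l θ x) := by
  -- The maximum is the admissible `M`: it dominates the square sums of all the kernel factors.
  refine ⟨3 * (2 + A + 4 * B + 54 * (1 + Real.exp 1 * Real.log 4 * A + B) *
    max (4 * (Real.exp 1 * Real.log 4 * A)) (16 * A ^ 3 + 2 * A * B ^ 2)), fun x l θ hx h hl hθ => ?_⟩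
  have hw := h.isLogWeight (by linarith) hA.le hl
  have key := hw.turanKubilius (Nat.le_floor (by exact_mod_cast hx))
    (le_max_left (4 * (Real.exp 1 * Real.log 4 * A)) (16 * A ^ 3 + 2 * A * B ^ 2))
    (le_max_right _ _) hθ
  have h1 : firstMoment l θ x =
      ∑ q ∈ Finset.Icc 1 ⌊x⌋₊ with IsPrimePow q, θ q * ((l q / q : ℝ) : ℂ) := by
    refine Finset.sum_congr rfl fun q _ => ?_
    push_cast
    ring
  have h2 : secondMoment l θ x =
      ∑ q ∈ Finset.Icc 1 ⌊x⌋₊ with IsPrimePow q, l q / q * ‖θ q‖ ^ 2 :=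
    Finset.sum_congr rfl fun q _ => by ring
  rw [h1, h2]
  exact key
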